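/- Let $K$ be a field, let $S$ be a $K$-scheme of finite type and let $S'\to S$ be a finite étale cover (a finite étale morphism of schemes, $S'$ being a $K$-scheme through $S$). Let $L/K$ be a field extension where $L$ is a local field, that is, a field with a nontrivial absolute value which either is locally compact, or is nonarchimedean with valuation ring a henselian discrete valuation ring (such as the maximal unramified extension of a nonarchimedean local field). Fix an algebraic closure $\overline L$ of $L$, and give $S(L)=\operatorname{Hom}_K(\operatorname{Spec} L,S)$ the analytic topology, generated by the sets $\{s\in U(L) : f(s)\in V\}$ for $U\subseteq S$ affine open, $f\in\mathcal O_S(U)$ and $V\subseteq L$ open. For $s\in S(L)$ let $S'_s=S'\times_S\operatorname{Spec} L$ be the fibre at $s$, and let $L(S'_s(\overline L))\subseteq\overline L$ be the field generated over $L$ by the residue fields of the points of $S'_s(\overline L)$, embedded in $\overline L$ through these points. Then, for every $s\in S(L)$, $L(S'_s(\overline L))/L$ is a finite Galois extension, and there are an integer $n\ge 0$, finite groups $H_1,\dots,H_n$ and pairwise disjoint open subsets $U_1,\dots,U_n$ of $S(L)$ with $S(L)=U_1\cup\dots\cup U_n$ such that, for all $i\in\{1,\dots,n\}$ and all $s\in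 S(L)$, $$s\in U_i\iff \operatorname{Gal}\bigl(L(S'_s(\overline L))/L\bigr)\simeq H_i .$$ -/

import Mathlib

open CategoryTheory CategoryTheory.Limits AlgebraicGeometry
open scoped NNReal

universe u

noncomputable section

/-- A local field: a field with a nontrivial absolute value which is locally compact (so `ℝ`, `ℂ`,
or a finite extension of `ℚ_p` or of `𝔽_p((t))`), or which is nonarchimedean, with
valuation ring a henselian discrete valuation ring (so complete discretely valued fields, and also
the maximal unramified extension of a nonarchimedean local field, which is neither locally compact
nor complete). -/
def IsLocalField (L : Type u) [NontriviallyNormedField L] : Prop :=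
  LocallyCompactSpace L ∨
    ∃ _ : IsUltrametricDist L,
      IsDiscreteValuationRing (NormedField.valuation (K := L)).integer ∧
        HenselianLocalRing (NormedField.valuation (K := L)).integer

/-- The set `S(L) = Hom_K(Spec L, S)` of `L`-points of a `K`-scheme `p : S ⟶ Spec K`. -/
def KPoints {K : Type u} [Field K] {S : Scheme.{u}} (p : S ⟶ Spec (.of K))
    (L : Type u) [Field L] [Algebra K L] : Type u :=
  {s : Spec (.of L) ⟶ S // s ≫ p = Spec.map (CommRingCat.ofHom (algebraMap K L))}

/-- The value `f(t) ∈ L` of a global function `f` on a scheme `U` at a point `t : Spec L ⟶ U`. -/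
def evalAt {L : Type u} [Field L] {U : Scheme.{u}} (t : Spec (.of L) ⟶ U) (f : Γ(U, ⊤)) : L :=
  (Scheme.ΓSpecIso (.of L)).hom.hom (t.appTop.hom f)

/-- The analytic topology on `S(L)`, for a topological field `L`: it is generated by the sets of
those points that lie in an affine open `U` of `S` and at which a given regular function on `U`
takes its value in a given open subset `V` of `L`. -/
instance KPoints.instTopologicalSpace {K : Type u} [Field K] {S : Scheme.{u}}
    (p : S ⟶ Spec (.of K)) (L : Type u) [Field L] [Algebra K L] [TopologicalSpace L] :
    TopologicalSpace (KPoints p L) :=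
  TopologicalSpace.generateFrom
    {W | ∃ (U : S.Opens) (_ : IsAffineOpen U) (f : Γ(U.toScheme, ⊤)) (V : Set L), IsOpen V ∧
      W = {s | ∃ t : Spec (.of L) ⟶ U.toScheme, t ≫ U.ι = s.1 ∧ evalAt t f ∈ V}}

/-- For an `L`-scheme `q : X ⟶ Spec L` and an extension `Ω` of `L`, the subfield `L(X(Ω))` of `Ω`
generated over `L` by the residue fields of the points `x ∈ X(Ω)`, embedded in `Ω` through `x`. -/
def fieldOfPoints {L : Type u} [Field L] {X : Scheme.{u}} (q : X ⟶ Spec (.of L))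
    (Ω : Type u) [Field Ω] [Algebra L Ω] : IntermediateField L Ω :=
  IntermediateField.adjoin L
    (⋃ x : KPoints q Ω, Set.range (Scheme.SpecToEquivOfField Ω X x.1).2.hom)

/-- The field `L(S'_s(Ω))` generated by the `Ω`-points of the fibre `S'_s = S' ×_S Spec L` of
`f : S' ⟶ S` at an `L`-point `s` of `S`. -/
def fibreField {K : Type u} [Field K] {S S' : Scheme.{u}} (f : S' ⟶ S) {p : S ⟶ Spec (.of K)}
    {L : Type u} [Field L] [Algebra K L] (s : KPoints p L)
    (Ω : Type u) [Field Ω] [Algebra L Ω] : IntermediateField L Ω :=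
  fieldOfPoints (pullback.snd f s.1) Ω

end

/-! The heart is a version of Krasner's lemma that never extends the absolute value to the algebraic
closure. The only analytic input is that simple roots in $L$ persist under small changes of the
coefficients (`StableSimpleRoots`). It follows from the inverse function theorem over complete
fields and from Hensel's lemma in the henselian case.

Let $f$ over $L$ have distinct roots $a_j$, and let $g$ be close to $f$, with roots $b_j$. For a
polynomial $\ell$ over $L$ form the resolvent $\prod_\pi (X-\sum_j \ell(b_j)a_{\pi j})$ over all
matchings $\pi$ of the two root sets. It is defined over $L$, and its coefficients depend
continuously on those of $g$. For $g=f$ and generic $\ell$ the identity matching gives a simple root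
in $L$. Hence for $g$ near $f$ the resolvent still has a simple root in $L$, which comes from
exactly one matching. Galois invariance of that root makes this matching Galois equivariant, so $f$
and $g$ have the same splitting field (`StableSimpleRoots.eventually_adjoin_roots_eq`).

Locally on $S$ the cover is a finite free étale algebra whose structure constants are regular
functions, hence continuous on $S(L)$. An element separating the geometric points of one fibre has
as characteristic polynomial such an $f$, whose splitting field is the field of the fibre; keeping
its coordinates fixed gives the nearby $g$. So the field itself, not only its Galois group, is
locally constant (`exists_opens_fibreField`). Quasi-compactness bounds the orders of the Galois
groups, leaving finitely many isomorphism classes. -/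

/-- Simple roots of polynomials over a topological field persist under small perturbations of the
coefficients, and move little. -/
def StableSimpleRoots (L : Type*) [Field L] [TopologicalSpace L] : Prop :=
  ∀ (N : ℕ) (c₀ : Fin (N + 1) → L) (a : L), ∑ i : Fin (N + 1), c₀ i * a ^ (i : ℕ) = 0 →
    ∑ i : Fin (N + 1), c₀ i * ((i : ℕ) * a ^ ((i : ℕ) - 1)) ≠ 0 →
    ∀ U ∈ nhds a, ∀ᶠ c in nhds c₀, ∃ z ∈ U, ∑ i : Fin (N + 1), c i * z ^ (i : ℕ) = 0

-- The map (coefficients, point) ↦ (coefficients, value) is strictly differentiable, with surjective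
-- derivative at a simple root. By completeness it is therefore open there, and targets $(c,0)$ with
-- $c$ near $c_0$ have preimages with second coordinate in `U`.
open Filter Topology in
theorem stableSimpleRoots_of_completeSpace (L : Type*) [NontriviallyNormedField L]
    [CompleteSpace L] : StableSimpleRoots L := by
  intro N c₀ a ha ha' U hU
  let G : (Fin (N + 1) → L) × L → (Fin (N + 1) → L) × L :=
    fun q => (q.1, ∑ i : Fin (N + 1), q.1 i * q.2 ^ (i : ℕ))
  let D : (Fin (N + 1) → L) × L →L[L] L :=
    ∑ i : Fin (N + 1), (c₀ i • ((((i : ℕ) : L) * a ^ ((i : ℕ) - 1)) • ContinuousLinearMap.snd L _ _)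
      + a ^ (i : ℕ) • (ContinuousLinearMap.proj i).comp (ContinuousLinearMap.fst L _ _))
  have hD : HasStrictFDerivAt G ((ContinuousLinearMap.fst L _ _).prod D) (c₀, a) := by
    refine hasStrictFDerivAt_fst.prodMk (HasStrictFDerivAt.fun_sum fun i _ => ?_)
    have h1 : HasStrictFDerivAt (fun q : (Fin (N + 1) → L) × L => q.1 i)
        ((ContinuousLinearMap.proj (R := L) (φ := fun _ : Fin (N + 1) => L) i).comp
          (ContinuousLinearMap.fst L _ _)) (c₀, a) :=
      ((ContinuousLinearMap.proj (R := L) (φ := fun _ : Fin (N + 1) => L) i).comp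
        (ContinuousLinearMap.fst L (Fin (N + 1) → L) L)).hasStrictFDerivAt
    have h2 : HasStrictFDerivAt (fun q : (Fin (N + 1) → L) × L => q.2 ^ (i : ℕ))
        ((((i : ℕ) : L) * a ^ ((i : ℕ) - 1)) • ContinuousLinearMap.snd L _ _) (c₀, a) :=
      (hasStrictDerivAt_pow (i : ℕ) a).comp_hasStrictFDerivAt (c₀, a) hasStrictFDerivAt_snd
    exact h1.mul h2
  have hsurj : ((ContinuousLinearMap.fst L (Fin (N + 1) → L) L).prod D).range = ⊤ := by
    rw [LinearMap.range_eq_top]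
    rintro ⟨c, w⟩
    -- The second entry solves the linear equation `D (c, y) = w` for `y`, dividing by the
    -- derivative at the simple root.
    refine ⟨(c, (∑ i : Fin (N + 1), c₀ i * ((i : ℕ) * a ^ ((i : ℕ) - 1)))⁻¹ *
      (w - ∑ i : Fin (N + 1), a ^ (i : ℕ) * c i)), ?_⟩
    refine Prod.ext rfl ?_
    simp only [D, ContinuousLinearMap.coe_coe, ContinuousLinearMap.prod_apply]
    simp only [sum_apply, add_apply,
      smul_apply, smul_eq_mul, ContinuousLinearMap.coe_snd',
      ContinuousLinearMap.comp_apply, ContinuousLinearMap.coe_fst', ContinuousLinearMap.proj_apply,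
      Finset.sum_add_distrib, ← mul_assoc]
    rw [← Finset.sum_mul, ← Finset.sum_mul]
    simp only [mul_assoc] at ha' ⊢
    rw [mul_inv_cancel_left₀ ha', sub_add_cancel]
  have hmap := hD.map_nhds_eq_of_surj hsurj
  have hG : G (c₀, a) = (c₀, 0) := by simp [G, ha]
  rw [hG] at hmap
  have hmem : G '' (Set.univ ×ˢ U) ∈ 𝓝 (c₀, (0 : L)) := by
    rw [← hmap]
    exact image_mem_map (prod_mem_nhds univ_mem hU)
  have ht : Tendsto (fun c : Fin (N + 1) → L => (c, (0 : L))) (𝓝 c₀) (𝓝 (c₀, 0)) :=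
    (Continuous.prodMk_left (0 : L)).tendsto c₀
  filter_upwards [ht hmem] with c hc
  obtain ⟨⟨c', z⟩, ⟨-, hz⟩, h⟩ := hc
  obtain ⟨rfl, h2⟩ := Prod.mk.inj h
  exact ⟨z, hz, h2⟩

/-! ### Stability of simple roots over henselian valued fields -/

section Henselian

variable {L : Type*} [NontriviallyNormedField L] [IsUltrametricDist L]

theorem mem_integer_valuation_iff {x : L} :
    x ∈ (NormedField.valuation (K := L)).integer ↔ ‖x‖ ≤ 1 := by
  rw [Valuation.mem_integer_iff, NormedField.valuation_apply, ← NNReal.coe_le_coe]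
  simp

theorem mem_maximalIdeal_integer_of_norm_lt_one
    [IsLocalRing (NormedField.valuation (K := L)).integer]
    {x : (NormedField.valuation (K := L)).integer} (hx : ‖(x : L)‖ < 1) :
    x ∈ IsLocalRing.maximalIdeal (NormedField.valuation (K := L)).integer := by
  rw [IsLocalRing.mem_maximalIdeal, mem_nonunits_iff]
  intro h
  obtain ⟨y, hy⟩ := h.exists_right_inv
  have h1 : ‖(x : L)‖ * ‖(y : L)‖ = 1 := by
    rw [← norm_mul, ← Subring.coe_mul, hy]; simp
  have h2 := mem_integer_valuation_iff.1 y.2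
  nlinarith [norm_nonneg (x : L), norm_nonneg (y : L)]

open Polynomial in
/-- A root `v ≡ 1` of a polynomial `X ^ (m + 1) - X ^ m + (small)` over a henselian ring. -/
theorem HenselianLocalRing.exists_root_sub_one_mem {R : Type*} [CommRing R] [HenselianLocalRing R]
    (m : ℕ) (e : ℕ → R) (he : ∀ j, e j ∈ IsLocalRing.maximalIdeal R) :
    ∃ v : R, IsUnit v ∧
      v ^ (m + 1) - v ^ m + ∑ j ∈ Finset.range m, e j * v ^ (m - 1 - j) = 0 := by
  set r : R[X] := ∑ j ∈ Finset.range m, C (e j) * X ^ (m - 1 - j) with hr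
  have hrdeg : r.degree ≤ m := by
    refine (degree_sum_le _ _).trans (Finset.sup_le fun j _ => (degree_C_mul_X_pow_le _ _).trans ?_)
    exact_mod_cast (by omega : m - 1 - j ≤ m)
  have hmonic : (X ^ (m + 1) + (- X ^ m + r) : R[X]).Monic := by
    refine monic_X_pow_add ?_
    refine lt_of_le_of_lt (degree_add_le_of_degree_le ?_ hrdeg) (by exact_mod_cast m.lt_succ_self)
    rw [degree_neg]
    exact degree_X_pow_le m
  have hr1 : r.eval 1 ∈ IsLocalRing.maximalIdeal R := by
    rw [hr, eval_finsetSum]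
    exact Ideal.sum_mem _ fun j _ => by simpa using he j
  have hr2 : r.derivative.eval 1 ∈ IsLocalRing.maximalIdeal R := by
    rw [hr, derivative_sum, eval_finsetSum]
    refine Ideal.sum_mem _ fun j _ => ?_
    rw [derivative_C_mul, eval_mul, eval_C]
    exact Ideal.mul_mem_right _ _ (he j)
  -- Modulo the maximal ideal the polynomial is $X^{m+1}-X^m$, whose derivative at its root 1 is
  -- $(m+1)-m=1$.
  obtain ⟨v, hv, hv1⟩ := HenselianLocalRing.is_henselian _ hmonic 1 (by simpa using hr1) (by
    have : eval 1 (derivative (X ^ (m + 1) + (- X ^ m + r) : R[X])) = 1 + r.derivative.eval 1 := by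
      simp only [derivative_add, derivative_neg, derivative_X_pow, eval_add, eval_neg, eval_mul,
        eval_pow, eval_X, one_pow, eval_C, mul_one]
      push_cast
      ring
    rw [this]
    by_contra hc
    have h1 := Ideal.sub_mem _ ((IsLocalRing.mem_maximalIdeal _).2 hc) hr2
    rw [add_sub_cancel_right] at h1
    exact (Ideal.ne_top_iff_one _).1 (IsLocalRing.maximalIdeal.isMaximal R).ne_top h1)
  refine ⟨v, ?_, ?_⟩
  · by_contra hc
    have h1 := Ideal.sub_mem _ ((IsLocalRing.mem_maximalIdeal _).2 hc) hv1
    rw [sub_sub_cancel] at h1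
    exact (Ideal.ne_top_iff_one _).1 (IsLocalRing.maximalIdeal.isMaximal R).ne_top h1
  · have := hv
    rw [IsRoot, hr] at this
    simp only [eval_add, eval_neg, eval_pow, eval_X, eval_finsetSum, eval_mul, eval_C] at this
    linear_combination this

/-- The substitution $u=-(c_0/c_1)v^{-1}$ rescales by the Newton approximation $-c_0/c_1$ and
reverses the polynomial. It becomes monic in $v$, so Hensel's lemma for monic polynomials applies.
-/
theorem sum_range_mul_neg_div_mul_inv_pow {F : Type*} [Field F] (m : ℕ) (c : ℕ → F) {v : F}
    (h1 : c 1 ≠ 0) (hv : v ≠ 0) :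
    ∑ i ∈ Finset.range (m + 2), c i * (-(c 0 / c 1) * v⁻¹) ^ i =
      c 0 / v ^ (m + 1) * (v ^ (m + 1) - v ^ m + ∑ j ∈ Finset.range m,
        (-1) ^ j * (c (j + 2) * (c 0 ^ (j + 1) / c 1 ^ (j + 2))) * v ^ (m - 1 - j)) := by
  rw [Finset.sum_range_succ', Finset.sum_range_succ', mul_add, Finset.mul_sum]
  have : ∀ j ∈ Finset.range m, c (j + 1 + 1) * (-(c 0 / c 1) * v⁻¹) ^ (j + 1 + 1) =
      c 0 / v ^ (m + 1) * ((-1) ^ j * (c (j + 2) * (c 0 ^ (j + 1) / c 1 ^ (j + 2))) *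
        v ^ (m - 1 - j)) := by
    intro j hj
    have hj' : m + 1 = (m - 1 - j) + (j + 2) := by have := Finset.mem_range.1 hj; omega
    rw [hj', pow_add v (m - 1 - j), show j + 1 + 1 = j + 2 from rfl, mul_pow, neg_pow, div_pow,
      inv_pow]
    field_simp
    ring
  rw [Finset.sum_congr rfl this, add_assoc, add_comm]
  congr 1
  simp only [zero_add, pow_one, pow_zero, mul_one]
  field_simp
  ring

/-- If the linear coefficient dominates, then a polynomial over a henselian valued field has a root
of the size predicted by its first two coefficients. -/
theorem exists_root_of_henselian [HenselianLocalRing (NormedField.valuation (K := L)).integer]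
    (m : ℕ) (c : ℕ → L) (h1 : c 1 ≠ 0)
    (hc : ∀ j < m, ‖c (j + 2) * (c 0 ^ (j + 1) / c 1 ^ (j + 2))‖ < 1) :
    ∃ u : L, ‖u‖ ≤ ‖c 0 / c 1‖ ∧ ∑ i ∈ Finset.range (m + 2), c i * u ^ i = 0 := by
  let e : ℕ → (NormedField.valuation (K := L)).integer := fun j =>
    if h : j < m then ⟨(-1) ^ j * (c (j + 2) * (c 0 ^ (j + 1) / c 1 ^ (j + 2))),
      mem_integer_valuation_iff.2 (by 
        rw [norm_mul, norm_pow, norm_neg, norm_one, one_pow, one_mul]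
        exact (hc j h).le)⟩
    else 0
  have he : ∀ j, e j ∈ IsLocalRing.maximalIdeal (NormedField.valuation (K := L)).integer := by
    intro j
    by_cases h : j < m
    · simp only [e, h, dif_pos]
      refine mem_maximalIdeal_integer_of_norm_lt_one ?_
      rw [norm_mul, norm_pow, norm_neg, norm_one, one_pow, one_mul]
      exact hc j h
    · simp only [e, h, dif_neg, not_false_eq_true]
      exact Ideal.zero_mem _
  obtain ⟨v, hv, hroot⟩ := HenselianLocalRing.exists_root_sub_one_mem m e he
  obtain ⟨y, hy⟩ := hv.exists_right_inv
  have hvy : (v : L) * y = 1 := by rw [← Subring.coe_mul, hy]; simp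
  have hv0 : (v : L) ≠ 0 := left_ne_zero_of_mul_eq_one hvy
  have hroot' : (v : L) ^ (m + 1) - (v : L) ^ m + ∑ j ∈ Finset.range m,
      (-1) ^ j * (c (j + 2) * (c 0 ^ (j + 1) / c 1 ^ (j + 2))) * (v : L) ^ (m - 1 - j) = 0 := by
    have := congrArg (Subtype.val) hroot
    push_cast at this
    rw [← this]
    congr 1
    refine Finset.sum_congr rfl fun j hj => ?_
    simp only [e, Finset.mem_range.1 hj, dif_pos]
  refine ⟨- (c 0 / c 1) * y, ?_, ?_⟩
  · rw [norm_mul, norm_neg]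
    exact mul_le_of_le_one_right (norm_nonneg _) (mem_integer_valuation_iff.1 y.2)
  · have hy' : (y : L) = (v : L)⁻¹ := (inv_eq_of_mul_eq_one_right hvy).symm
    rw [hy', sum_range_mul_neg_div_mul_inv_pow m c h1 hv0, hroot', mul_zero]

-- After a Taylor shift to `a`, the constant coefficient tends to 0 and the linear one to a nonzero
-- limit. The smallness conditions of `exists_root_of_henselian` thus hold eventually, and the bound
-- on the root puts it in `U`.
open Polynomial Filter Topology in
theorem stableSimpleRoots_of_henselian
    [HenselianLocalRing (NormedField.valuation (K := L)).integer] : StableSimpleRoots L := by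
  intro N c₀ a ha ha' U hU
  obtain _ | m := N
  · simp at ha'
  let p : (Fin (m + 2) → L) → L[X] := fun c => ∑ i, C (c i) * X ^ (i : ℕ)
  let q : ℕ → (Fin (m + 2) → L) → L := fun k c => (taylor a (p c)).coeff k
  have hq : ∀ k, Continuous (q k) := by
    intro k
    have : q k = fun c => ∑ i : Fin (m + 2), c i * ((X + C a) ^ (i : ℕ) : L[X]).coeff k := by
      ext c
      simp [q, p, map_sum, taylor_mul, taylor_C]
    rw [this]
    fun_prop
  have hq0 : q 0 c₀ = 0 := by
    simp only [q, taylor_coeff_zero, p, eval_finsetSum, eval_mul, eval_C, eval_pow, eval_X]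
    exact ha
  have hq1 : q 1 c₀ ≠ 0 := by
    simp only [q, taylor_coeff_one, p, derivative_sum, derivative_C_mul_X_pow, eval_finsetSum,
      eval_mul, eval_C, eval_pow, eval_X]
    simpa only [mul_assoc] using ha'
  have hroot : ∀ c u, ∑ i ∈ Finset.range (m + 2), q i c * u ^ i =
      ∑ i : Fin (m + 2), c i * (u + a) ^ (i : ℕ) := by
    intro c u
    have hd : (taylor a (p c)).natDegree < m + 2 := by
      rw [natDegree_taylor]
      refine Nat.lt_succ_of_le (natDegree_sum_le_of_forall_le _ _ fun i _ => ?_)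
      exact (natDegree_C_mul_X_pow_le _ _).trans (Nat.le_of_lt_succ i.2)
    rw [← eval_eq_sum_range' hd, taylor_eval]
    simp only [p, eval_finsetSum, eval_mul, eval_C, eval_pow, eval_X]
  have hsmall : ∀ j, ∀ᶠ c in 𝓝 c₀, ‖q (j + 2) c * (q 0 c ^ (j + 1) / q 1 c ^ (j + 2))‖ < 1 := by
    intro j
    have : Tendsto (fun c => ‖q (j + 2) c * (q 0 c ^ (j + 1) / q 1 c ^ (j + 2))‖) (𝓝 c₀)
        (𝓝 ‖q (j + 2) c₀ * (q 0 c₀ ^ (j + 1) / q 1 c₀ ^ (j + 2))‖) :=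
      (((hq _).tendsto c₀).mul ((((hq 0).tendsto c₀).pow _).div (((hq 1).tendsto c₀).pow _)
        (pow_ne_zero _ hq1))).norm
    rw [hq0] at this
    simp only [ne_eq, Nat.add_eq_zero_iff, one_ne_zero, and_false, not_false_eq_true, zero_pow,
      zero_div, mul_zero, norm_zero] at this
    exact this.eventually_lt_const one_pos
  obtain ⟨ε, hε, hεU⟩ := Metric.mem_nhds_iff.1 hU
  have hε' : ∀ᶠ c in 𝓝 c₀, ‖q 0 c / q 1 c‖ < ε := by
    have : Tendsto (fun c => ‖q 0 c / q 1 c‖) (𝓝 c₀) (𝓝 ‖q 0 c₀ / q 1 c₀‖) :=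
      (((hq 0).tendsto c₀).div ((hq 1).tendsto c₀) hq1).norm
    rw [hq0, zero_div, norm_zero] at this
    exact this.eventually_lt_const hε
  have hall : ∀ᶠ c in 𝓝 c₀, ∀ j ∈ Finset.range m,
      ‖q (j + 2) c * (q 0 c ^ (j + 1) / q 1 c ^ (j + 2))‖ < 1 :=
    (Finset.eventually_all _).2 fun j _ => hsmall j
  filter_upwards [hall, hε', ((hq 1).tendsto c₀).eventually_ne hq1] with c h1 h2 h3
  obtain ⟨u, hu, hu0⟩ := exists_root_of_henselian m (fun k => q k c) h3
    fun j hj => h1 j (Finset.mem_range.2 hj)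
  refine ⟨u + a, hεU ?_, by rw [← hroot, hu0]⟩
  rw [Metric.mem_ball, dist_eq_norm, add_sub_cancel_right]
  exact hu.trans_lt h2

end Henselian

theorem IsLocalField.stableSimpleRoots {L : Type u} [NontriviallyNormedField L]
    (hL : IsLocalField L) : StableSimpleRoots L := by
  obtain h | ⟨hu, -, hH⟩ := hL
  · have : ProperSpace L := .of_locallyCompactSpace L
    exact stableSimpleRoots_of_completeSpace L
  · exact stableSimpleRoots_of_henselian

open Polynomial Filter Topology

/-! ### Symmetric functions of roots and continuity in the coefficients -/

section SymmetricFunctions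

/-- A symmetric polynomial in the roots of a monic polynomial is a polynomial in its
coefficients. -/
theorem exists_aeval_eq_aeval_coeff_of_isSymmetric {R E : Type*} [CommRing R] [CommRing E]
    [Algebra R E] {d : ℕ} {P : MvPolynomial (Fin d) R} (hP : P.IsSymmetric) :
    ∃ Φ : MvPolynomial (Fin d) R, ∀ b : Fin d → E, MvPolynomial.aeval b P =
      MvPolynomial.aeval (fun i : Fin d => (∏ j, (X - C (b j))).coeff i) Φ := by
  obtain ⟨Q, hQ⟩ := MvPolynomial.esymmAlgHom_surjective (σ := Fin d) R
    (Fintype.card_fin d).le ⟨P, hP⟩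
  refine ⟨MvPolynomial.aeval (fun i : Fin d =>
    (-1) ^ (i + 1 : ℕ) * MvPolynomial.X (Fin.rev i)) Q, fun b => ?_⟩
  have hQ' : MvPolynomial.aeval (fun i : Fin d => MvPolynomial.esymm (Fin d) R (i + 1)) Q = P :=
    (MvPolynomial.esymmAlgHom_apply Q).symm.trans (congrArg Subtype.val hQ)
  rw [← hQ', ← AlgHom.comp_apply, ← AlgHom.comp_apply, MvPolynomial.comp_aeval,
    MvPolynomial.comp_aeval]
  congr 2
  ext i
  have h : (∏ j, (X - C (b j))).coeff (d - (i + 1)) =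
      (-1) ^ (i + 1 : ℕ) * (Finset.univ.val.map b).esymm (i + 1) := by
    have h1 := Multiset.prod_X_sub_C_coeff (Finset.univ.val.map b) (k := d - (i + 1))
      (by simp)
    rw [Multiset.map_map] at h1
    simp only [Multiset.card_map, Finset.card_val, Finset.card_univ, Fintype.card_fin] at h1
    rw [Nat.sub_sub_self (by omega : (i : ℕ) + 1 ≤ d)] at h1
    exact h1
  rw [MvPolynomial.aeval_esymm_eq_multiset_esymm]
  simp only [map_mul, map_pow, map_neg, map_one, MvPolynomial.aeval_X, Fin.val_rev]
  rw [h, ← mul_assoc, ← mul_pow]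
  simp

variable {L Ω : Type*} [Field L] [Field Ω] [Algebra L Ω] {d : ℕ}

/-- If a symmetric polynomial over an extension takes a value in the ground field at the roots of a
monic polynomial over the ground field, then this value depends continuously on the
coefficients. -/
theorem exists_continuous_coeff_of_isSymmetric [TopologicalSpace L] [IsTopologicalRing L]
    {P : MvPolynomial (Fin d) Ω} (hP : P.IsSymmetric) :
    ∃ Ψ : (Fin d → L) → L, Continuous Ψ ∧ ∀ (g : L[X]) (b : Fin d → Ω) (y : L),
      g.map (algebraMap L Ω) = ∏ j, (X - C (b j)) → MvPolynomial.aeval b P = algebraMap L Ω y →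
      y = Ψ fun i => g.coeff i := by
  obtain ⟨Φ, hΦ⟩ := exists_aeval_eq_aeval_coeff_of_isSymmetric (E := Ω) hP
  -- No topology on `Ω` is needed: an `L`-linear retraction `Ω → L` turns the coefficients of `Φ`
  -- into elements of `L` without changing values that already lie in `L`.
  obtain ⟨r, hr⟩ := (Algebra.linearMap L Ω).exists_leftInverse_of_injective
    (LinearMap.ker_eq_bot.2 (algebraMap L Ω).injective)
  refine ⟨fun c => ∑ s ∈ Φ.support, (∏ i, c i ^ s i) * r (Φ.coeff s), by fun_prop, ?_⟩
  intro g b y hg hy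
  have h1 : r (algebraMap L Ω y) = y := LinearMap.congr_fun hr y
  rw [← h1, ← hy, hΦ, ← hg, MvPolynomial.aeval_def, MvPolynomial.eval₂_eq', map_sum]
  refine Finset.sum_congr rfl fun s _ => ?_
  simp only [coeff_map, Algebra.algebraMap_self, RingHom.id_apply]
  simp only [← map_pow, ← map_prod]
  rw [mul_comm, ← Algebra.smul_def, map_smul, smul_eq_mul]

/-- Having distinct roots is an open condition on the coefficients. -/
theorem eventually_injective_roots [TopologicalSpace L] [IsTopologicalRing L] [T1Space L]
    {ι : Type*} {l : Filter ι} {g : ι → L[X]} {f : L[X]} {a : Fin d → Ω} {b : ι → Fin d → Ω}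
    (hf : f.map (algebraMap L Ω) = ∏ j, (X - C (a j)))
    (hg : ∀ t, (g t).map (algebraMap L Ω) = ∏ j, (X - C (b t j)))
    (ha : Function.Injective a)
    (hlim : ∀ i, Tendsto (fun t => (g t).coeff i) l (𝓝 (f.coeff i))) :
    ∀ᶠ t in l, Function.Injective (b t) := by
  -- Up to sign, the discriminant.
  let P : MvPolynomial (Fin d) L :=
    ∏ i, ∏ j, if i = j then 1 else (MvPolynomial.X i - MvPolynomial.X j)
  have hP : P.IsSymmetric := by
    intro e
    simp only [P, map_prod]
    refine Fintype.prod_equiv e _ _ fun i => Fintype.prod_equiv e _ _ fun j => ?_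
    by_cases h : i = j <;> simp [h]
  have hPeval : ∀ b : Fin d → Ω, MvPolynomial.aeval b P ≠ 0 ↔ Function.Injective b := by
    intro b
    simp only [P, map_prod, Finset.prod_ne_zero_iff, Finset.mem_univ, true_implies]
    refine ⟨fun h i j hij => ?_, fun h i j => ?_⟩
    · by_contra hne
      have := h i j
      simp [hne, hij] at this
    · by_cases hij : i = j
      · simp [hij]
      · simpa [hij, sub_eq_zero] using fun h' => hij (h h')
  obtain ⟨Φ, hΦ⟩ := exists_aeval_eq_aeval_coeff_of_isSymmetric (E := Ω) hP
  have key : ∀ (g : L[X]) (b : Fin d → Ω), g.map (algebraMap L Ω) = ∏ j, (X - C (b j)) →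
      (MvPolynomial.aeval (fun i : Fin d => g.coeff i) Φ ≠ 0 ↔ Function.Injective b) := by
    intro g b hgb
    rw [← hPeval, hΦ, ← hgb]
    simp only [coeff_map]
    have := MvPolynomial.aeval_algebraMap_apply Ω (fun i : Fin d => g.coeff i) Φ
    rw [Function.comp_def] at this
    rw [this, ne_eq, ne_eq, FaithfulSMul.algebraMap_eq_zero_iff]
  have hcont : Continuous fun c : Fin d → L => MvPolynomial.aeval c Φ :=
    MvPolynomial.continuous_eval Φ
  have hlim' : Tendsto (fun t => MvPolynomial.aeval (fun i : Fin d => (g t).coeff i) Φ) l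
      (𝓝 (MvPolynomial.aeval (fun i : Fin d => f.coeff i) Φ)) :=
    (hcont.tendsto _).comp (tendsto_pi_nhds.2 fun i => hlim i)
  filter_upwards [hlim'.eventually_ne ((key f a hf).2 ha)] with t ht
  exact (key _ _ (hg t)).1 ht

end SymmetricFunctions

/-! ### Galois theory inside a normal, possibly inseparable, extension -/

section Galois

variable {L Ω : Type*} [Field L] [Field Ω] [Algebra L Ω]

/-- A separable element outside `L` has another conjugate, and normality provides an automorphism
moving it there. -/
theorem IsSeparable.mem_range_algebraMap_of_forall_fixed [Normal L Ω] {x : Ω}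
    (hx : IsSeparable L x) (h : ∀ σ : Ω ≃ₐ[L] Ω, σ x = x) : x ∈ (algebraMap L Ω).range := by
  by_contra hc
  obtain ⟨y, hy, hxy⟩ := (notMem_iff_exists_ne_and_isConjRoot hx (Normal.splits inferInstance x)).1
    (fun hm => hc (Algebra.mem_bot.1 hm))
  obtain ⟨σ, rfl⟩ := isConjRoot_iff_exists_algEquiv.1 hxy
  exact hy (σ.injective (h σ))

/-- Families of separable elements with the same fixing group generate the same extension. -/
theorem adjoin_range_le_of_forall_fixed [Normal L Ω] {I J : Type*} {a : I → Ω} {b : J → Ω}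
    (hb : ∀ j, IsSeparable L (b j))
    (h : ∀ σ : Ω ≃ₐ[L] Ω, (∀ i, σ (a i) = a i) → ∀ j, σ (b j) = b j) :
    IntermediateField.adjoin L (Set.range b) ≤ IntermediateField.adjoin L (Set.range a) := by
  rw [IntermediateField.adjoin_le_iff]
  rintro _ ⟨j, rfl⟩
  set M := IntermediateField.adjoin L (Set.range a)
  have hs : IsSeparable M (b j) := (hb j).tower_top M
  have : Normal M Ω := Normal.tower_top_of_normal L M Ω
  obtain ⟨m, hm⟩ := hs.mem_range_algebraMap_of_forall_fixed fun σ =>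
    h (σ.restrictScalars L) (fun i => σ.commutes
      ⟨a i, IntermediateField.subset_adjoin L _ ⟨i, rfl⟩⟩) j
  rw [← hm]
  exact m.2

variable {d : ℕ}

/-- An automorphism permutes the roots of a polynomial over the ground field. -/
theorem exists_perm_of_map_eq_prod {f : L[X]} {a : Fin d → Ω}
    (hf : f.map (algebraMap L Ω) = ∏ j, (X - C (a j))) (ha : Function.Injective a)
    (σ : Ω ≃ₐ[L] Ω) : ∃ α : Equiv.Perm (Fin d), ∀ j, σ (a j) = a (α j) := by
  have h : ∀ j, ∃ k, σ (a j) = a k := by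
    intro j
    have h1 : aeval (a j) f = 0 := by
      rw [← eval_map_algebraMap, hf, eval_prod]
      exact Finset.prod_eq_zero (Finset.mem_univ j) (by simp)
    have h2 : aeval (σ (a j)) f = 0 := by
      rw [aeval_algHom_apply, h1, map_zero]
    rw [← eval_map_algebraMap, hf, eval_prod, Finset.prod_eq_zero_iff] at h2
    obtain ⟨k, -, hk⟩ := h2
    exact ⟨k, by simpa [sub_eq_zero] using hk⟩
  choose α hα using h
  have hinj : Function.Injective α := fun i j hij =>
    ha (σ.injective (by rw [hα, hα, hij]))
  exact ⟨Equiv.ofBijective α (Finite.injective_iff_bijective.1 hinj), hα⟩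

theorem isSeparable_of_map_eq_prod {f : L[X]} {a : Fin d → Ω}
    (hf : f.map (algebraMap L Ω) = ∏ j, (X - C (a j))) (ha : Function.Injective a) (j : Fin d) :
    IsSeparable L (a j) := by
  have hsep : f.Separable := by
    rw [← separable_map (algebraMap L Ω), hf]
    exact separable_prod_X_sub_C_iff.2 ha
  refine hsep.of_dvd (minpoly.dvd L _ ?_)
  rw [← eval_map_algebraMap, hf, eval_prod]
  exact Finset.prod_eq_zero (Finset.mem_univ j) (by simp)

end Galois

/-! ### The resolvent of matchings between two root sets -/

section Resolvent

variable {L Ω : Type*} [Field L] [Field Ω] [Algebra L Ω] {d : ℕ}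

/-- The number attached to a matching `π` of the families `b` and `a`. -/
noncomputable def matchingSum (ℓ : L[X]) (a b : Fin d → Ω) (π : Equiv.Perm (Fin d)) : Ω :=
  ∑ j, aeval (b j) ℓ * a (π j)

/-- The polynomial whose roots are the numbers attached to all matchings of `b` and `a`. -/
noncomputable def matchingResolvent (ℓ : L[X]) (a b : Fin d → Ω) : Polynomial Ω :=
  ∏ π : Equiv.Perm (Fin d), (X - C (matchingSum ℓ a b π))

/-- This describes the action of an automorphism on matchings, once it permutes the roots by `α` and
`β`; the resolvent is invariant because its factors are only permuted. -/
theorem matchingSum_comp (ℓ : L[X]) (a b : Fin d → Ω) (α β π : Equiv.Perm (Fin d)) :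
    matchingSum ℓ (a ∘ α) (b ∘ β) π = matchingSum ℓ a b (α * π * β⁻¹) := by
  refine Fintype.sum_equiv β _ _ fun j => ?_
  simp

theorem matchingResolvent_comp (ℓ : L[X]) (a b : Fin d → Ω) (α β : Equiv.Perm (Fin d)) :
    matchingResolvent ℓ (a ∘ α) (b ∘ β) = matchingResolvent ℓ a b := by
  refine Fintype.prod_equiv ((Equiv.mulLeft α).trans (Equiv.mulRight β⁻¹)) _ _ fun π => ?_
  rw [matchingSum_comp]
  rfl

theorem map_matchingSum {Ω' : Type*} [Field Ω'] [Algebra L Ω'] (σ : Ω →ₐ[L] Ω') (ℓ : L[X])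
    (a b : Fin d → Ω) (π : Equiv.Perm (Fin d)) :
    σ (matchingSum ℓ a b π) = matchingSum ℓ (σ ∘ a) (σ ∘ b) π := by
  simp [matchingSum, aeval_algHom_apply]

theorem map_matchingResolvent {Ω' : Type*} [Field Ω'] [Algebra L Ω'] (σ : Ω →ₐ[L] Ω') (ℓ : L[X])
    (a b : Fin d → Ω) :
    (matchingResolvent ℓ a b).map (σ : Ω →+* Ω') = matchingResolvent ℓ (σ ∘ a) (σ ∘ b) := by
  simp [matchingResolvent, Polynomial.map_prod, ← map_matchingSum]

theorem natDegree_matchingResolvent (ℓ : L[X]) (a b : Fin d → Ω) :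
    (matchingResolvent ℓ a b).natDegree = d.factorial := by
  rw [matchingResolvent, natDegree_finsetProd_X_sub_C_eq_card, Finset.card_univ,
    Fintype.card_perm, Fintype.card_fin]

/-- A simple root of the resolvent comes from a single matching. -/
theorem eq_of_matchingSum_eq {ℓ : L[X]} {a b : Fin d → Ω} {π π' : Equiv.Perm (Fin d)}
    (h : matchingSum ℓ a b π' = matchingSum ℓ a b π)
    (h' : (matchingResolvent ℓ a b).derivative.eval (matchingSum ℓ a b π) ≠ 0) : π' = π := by
  by_contra hne
  refine h' ?_
  rw [matchingResolvent, ← Finset.mul_prod_erase _ _ (Finset.mem_univ π),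
    ← Finset.mul_prod_erase _ _ (Finset.mem_erase.2 ⟨hne, Finset.mem_univ π'⟩), h]
  simp [derivative_mul]

theorem derivative_matchingResolvent_eval_ne_zero {ℓ : L[X]} {a b : Fin d → Ω}
    {π : Equiv.Perm (Fin d)}
    (h : ∀ π', π' ≠ π → matchingSum ℓ a b π' ≠ matchingSum ℓ a b π) :
    (matchingResolvent ℓ a b).derivative.eval (matchingSum ℓ a b π) ≠ 0 := by
  rw [matchingResolvent, ← Finset.mul_prod_erase _ _ (Finset.mem_univ π), derivative_mul]
  simp only [derivative_sub, derivative_X, derivative_C, sub_zero, one_mul, eval_add, eval_mul,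
    eval_sub, eval_X, eval_C, sub_self, zero_mul, add_zero, eval_prod]
  refine Finset.prod_ne_zero_iff.2 fun τ hτ => sub_ne_zero.2 fun he => ?_
  exact h τ (Finset.ne_of_mem_erase hτ) he.symm

/-- For fixed `a` the coefficients of the resolvent are symmetric polynomials in `b`. -/
theorem exists_isSymmetric_coeff_matchingResolvent (ℓ : L[X]) (a : Fin d → Ω) (k : ℕ) :
    ∃ P : MvPolynomial (Fin d) Ω, P.IsSymmetric ∧
      ∀ b, MvPolynomial.aeval b P = (matchingResolvent ℓ a b).coeff k := by
  -- The resolvent with indeterminates in place of `b`; renaming them by `e` only replaces `π` by `π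
  -- * e⁻¹`.
  let Q : (MvPolynomial (Fin d) Ω)[X] := ∏ π : Equiv.Perm (Fin d),
    (X - C (∑ j, aeval (MvPolynomial.X j : MvPolynomial (Fin d) Ω) ℓ * MvPolynomial.C (a (π j))))
  refine ⟨Q.coeff k, fun e => ?_, fun b => ?_⟩
  · have hQ : Q.map ((MvPolynomial.rename e).toRingHom) = Q := by
      simp only [Q, Polynomial.map_prod]
      refine Fintype.prod_equiv (Equiv.mulRight e⁻¹) _ _ fun π => ?_
      rw [Polynomial.map_sub, map_X, map_C]
      congr 2
      simp only [map_sum, map_mul, AlgHom.toRingHom_eq_coe, RingHom.coe_coe, MvPolynomial.rename_C]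
      refine Fintype.sum_equiv e _ _ fun j => ?_
      have := aeval_algHom_apply ((MvPolynomial.rename (R := Ω) e).restrictScalars L)
        (MvPolynomial.X j) ℓ
      simp only [AlgHom.restrictScalars_apply, MvPolynomial.rename_X] at this
      simp [this]
    have := congrArg (fun p => p.coeff k) hQ
    simpa [coeff_map] using this
  · have hQ : Q.map ((MvPolynomial.aeval b).toRingHom) = matchingResolvent ℓ a b := by
      simp only [Q, Polynomial.map_prod, matchingResolvent, matchingSum]
      refine Finset.prod_congr rfl fun π _ => ?_
      rw [Polynomial.map_sub, map_X, map_C]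
      congr 2
      simp only [map_sum, map_mul, AlgHom.toRingHom_eq_coe, RingHom.coe_coe, MvPolynomial.aeval_C]
      refine Finset.sum_congr rfl fun j _ => ?_
      have := aeval_algHom_apply ((MvPolynomial.aeval (R := Ω) b).restrictScalars L)
        (MvPolynomial.X j) ℓ
      simp only [AlgHom.restrictScalars_apply, MvPolynomial.aeval_X] at this
      simp [this]
    rw [← hQ, coeff_map]
    rfl

/-- The resolvent of two separable polynomials over `L` is defined over `L`. -/
theorem exists_map_eq_matchingResolvent [Normal L Ω] (ℓ : L[X]) {f g : L[X]} {a b : Fin d → Ω}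
    (hf : f.map (algebraMap L Ω) = ∏ j, (X - C (a j))) (ha : Function.Injective a)
    (hg : g.map (algebraMap L Ω) = ∏ j, (X - C (b j))) (hb : Function.Injective b) :
    ∃ R : L[X], R.map (algebraMap L Ω) = matchingResolvent ℓ a b := by
  -- Working in the separable closure shows that the coefficients are separable, so Galois
  -- invariance suffices for descent.
  let a' : Fin d → separableClosure L Ω := fun j => ⟨a j, isSeparable_of_map_eq_prod hf ha j⟩
  let b' : Fin d → separableClosure L Ω := fun j => ⟨b j, isSeparable_of_map_eq_prod hg hb j⟩
  have h1 : (matchingResolvent ℓ a' b').map ((separableClosure L Ω).val : _ →+* Ω) =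
      matchingResolvent ℓ a b := map_matchingResolvent (separableClosure L Ω).val ℓ a' b'
  rw [← Polynomial.mem_lifts, Polynomial.lifts_iff_coeff_lifts]
  intro k
  refine IsSeparable.mem_range_algebraMap_of_forall_fixed ?_ fun σ => ?_
  · rw [← h1, coeff_map]
    exact ((matchingResolvent ℓ a' b').coeff k).2
  · obtain ⟨α, hα⟩ := exists_perm_of_map_eq_prod hf ha σ
    obtain ⟨β, hβ⟩ := exists_perm_of_map_eq_prod hg hb σ
    have h2 := map_matchingResolvent (σ : Ω →ₐ[L] Ω) ℓ a b
    rw [show ((σ : Ω →ₐ[L] Ω) ∘ a) = a ∘ α from funext hα,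
      show ((σ : Ω →ₐ[L] Ω) ∘ b) = b ∘ β from funext hβ, matchingResolvent_comp] at h2
    have h3 := congrArg (fun p => p.coeff k) h2
    rw [coeff_map] at h3
    exact h3

/-- Generic weights separate the identity matching from the others. -/
theorem exists_matchingSum_ne [Infinite L] {a : Fin d → Ω} (ha : Function.Injective a) :
    ∃ ℓ : L[X], ∀ π, π ≠ 1 → matchingSum ℓ a a π ≠ matchingSum ℓ a a 1 := by
  let T : Equiv.Perm (Fin d) → L[X] →ₗ[L] Ω := fun π =>
    ∑ j, (LinearMap.mulRight L (a (π j) - a j)) ∘ₗ (aeval (a j)).toLinearMap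
  have hT : ∀ π ℓ, T π ℓ = matchingSum ℓ a a π - matchingSum ℓ a a 1 := by
    intro π ℓ
    simp [T, matchingSum, mul_sub, Finset.sum_sub_distrib]
  by_contra! hc
  have hcov : ⋃ π : {π : Equiv.Perm (Fin d) // π ≠ 1},
      ((LinearMap.ker (T π.1) : Subspace L L[X]) : Set L[X]) = Set.univ := by
    refine Set.eq_univ_of_forall fun ℓ => ?_
    obtain ⟨π, hπ, h⟩ := hc ℓ
    exact Set.mem_iUnion.2 ⟨⟨π, hπ⟩, by simp [hT, h]⟩
  -- A vector space over an infinite field is not a finite union of proper subspaces, so some `T π`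
  -- vanishes; a Vandermonde argument on the powers of `X` then forces `π = 1`.
  obtain ⟨⟨π, hπ⟩, h⟩ := Subspace.exists_eq_top_of_iUnion_eq_univ hcov
  refine hπ (Equiv.ext fun j => ha ?_)
  have hv := Matrix.eq_zero_of_forall_pow_sum_mul_pow_eq_zero (v := fun j => a (π j) - a j) ha
    fun i => by
      have := LinearMap.congr_fun (LinearMap.ker_eq_top.1 h) (X ^ (i : ℕ))
      simpa [T, mul_comm] using this
  simpa [sub_eq_zero] using congrFun hv j

/-- If the resolvent of `f` and `g` has a simple root in the ground field, then `f` and `g` have the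
same splitting field. -/
theorem adjoin_roots_eq_of_simple_root_matchingResolvent [Normal L Ω] {ℓ : L[X]} {f g : L[X]}
    {a b : Fin d → Ω}
    (hf : f.map (algebraMap L Ω) = ∏ j, (X - C (a j))) (ha : Function.Injective a)
    (hg : g.map (algebraMap L Ω) = ∏ j, (X - C (b j))) (hb : Function.Injective b)
    {z : L} (hz : (matchingResolvent ℓ a b).eval (algebraMap L Ω z) = 0)
    (hz' : (matchingResolvent ℓ a b).derivative.eval (algebraMap L Ω z) ≠ 0) :
    IntermediateField.adjoin L (Set.range b) = IntermediateField.adjoin L (Set.range a) := by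
  rw [matchingResolvent, eval_prod, Finset.prod_eq_zero_iff] at hz
  obtain ⟨π, -, hπ⟩ := hz
  rw [eval_sub, eval_X, eval_C, sub_eq_zero] at hπ
  rw [hπ] at hz'
  -- Applying `σ` fixes `z` but turns `π` into `α * π * β⁻¹`; as the root is simple, the two
  -- matchings agree. Hence `α = 1` exactly when `β = 1`.
  have key : ∀ (σ : Ω ≃ₐ[L] Ω) (α β : Equiv.Perm (Fin d)), (∀ j, σ (a j) = a (α j)) →
      (∀ j, σ (b j) = b (β j)) → α * π = π * β := by
    intro σ α β hα hβ
    have h1 := map_matchingSum (σ : Ω →ₐ[L] Ω) ℓ a b π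
    rw [show ((σ : Ω →ₐ[L] Ω) ∘ a) = a ∘ α from funext hα,
      show ((σ : Ω →ₐ[L] Ω) ∘ b) = b ∘ β from funext hβ, matchingSum_comp, ← hπ] at h1
    rw [AlgHom.commutes, hπ] at h1
    exact mul_inv_eq_iff_eq_mul.1 (eq_of_matchingSum_eq h1.symm hz')
  refine le_antisymm (adjoin_range_le_of_forall_fixed (isSeparable_of_map_eq_prod hg hb) ?_)
    (adjoin_range_le_of_forall_fixed (isSeparable_of_map_eq_prod hf ha) ?_)
  · intro σ hσ j
    obtain ⟨β, hβ⟩ := exists_perm_of_map_eq_prod hg hb σ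
    have := key σ 1 β (fun j => by simpa using hσ j) hβ
    rw [one_mul, left_eq_mul] at this
    rw [hβ, this]
    rfl
  · intro σ hσ j
    obtain ⟨α, hα⟩ := exists_perm_of_map_eq_prod hf ha σ
    have := key σ α 1 hα (fun j => by simpa using hσ j)
    rw [mul_one, mul_eq_right] at this
    rw [hα, this]
    rfl

end Resolvent

/-! ### Krasner's lemma for splitting fields -/

section Krasner

/-- The derivative is jointly continuous in coefficients and point, so it stays nonzero at roots
close enough to `a`; this is where the control on the position of the new root is used. -/
theorem StableSimpleRoots.eventually_exists_simple_root {L : Type*} [Field L] [TopologicalSpace L]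
    [IsTopologicalRing L] [T1Space L] (hL : StableSimpleRoots L) {ι : Type*} {l : Filter ι}
    {N : ℕ} {h : ι → L[X]} {h₀ : L[X]} (hN : ∀ᶠ t in l, (h t).natDegree ≤ N)
    (hN₀ : h₀.natDegree ≤ N)
    (hlim : ∀ i, Tendsto (fun t => (h t).coeff i) l (𝓝 (h₀.coeff i))) {a : L}
    (ha : h₀.eval a = 0) (ha' : h₀.derivative.eval a ≠ 0) :
    ∀ᶠ t in l, ∃ z, (h t).eval z = 0 ∧ (h t).derivative.eval z ≠ 0 := by
  have hev : ∀ q : L[X], q.natDegree ≤ N → ∀ z, q.eval z =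
      ∑ i : Fin (N + 1), q.coeff i * z ^ (i : ℕ) := fun q hq z => by
    rw [eval_eq_sum_range' (Nat.lt_succ_of_le hq), Fin.sum_univ_eq_sum_range
      (fun i => q.coeff i * z ^ i)]
  have hev' : ∀ q : L[X], q.natDegree ≤ N → ∀ z, q.derivative.eval z =
      ∑ i : Fin (N + 1), q.coeff i * ((i : ℕ) * z ^ ((i : ℕ) - 1)) := fun q hq z => by
    rw [derivative_eval, sum_over_range' q (by simp) (N + 1) (Nat.lt_succ_of_le hq),
      Fin.sum_univ_eq_sum_range (fun i => q.coeff i * ((i : ℕ) * z ^ ((i : ℕ) - 1)))]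
    simp only [mul_assoc]
  have hD : ContinuousAt (fun q : (Fin (N + 1) → L) × L =>
      ∑ i : Fin (N + 1), q.1 i * ((i : ℕ) * q.2 ^ ((i : ℕ) - 1))) (fun i => h₀.coeff i, a) := by
    fun_prop
  rw [hev' h₀ hN₀] at ha'
  have hne := hD.eventually_ne ha'
  rw [nhds_prod_eq, eventually_prod_iff] at hne
  obtain ⟨p, hp, q, hq, hpq⟩ := hne
  have hroot := hL N (fun i => h₀.coeff i) a (by rw [← hev h₀ hN₀, ha]) ha' _ hq
  have htend : Tendsto (fun t => fun i : Fin (N + 1) => (h t).coeff i) l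
      (𝓝 fun i : Fin (N + 1) => h₀.coeff i) := tendsto_pi_nhds.2 fun i => hlim i
  filter_upwards [htend.eventually hroot, htend.eventually hp, hN] with t h1 h2 h3
  obtain ⟨z, hz, hz0⟩ := h1
  refine ⟨z, by rw [hev _ h3, hz0], ?_⟩
  rw [hev' _ h3]
  exact hpq h2 hz

/-- The splitting field of a separable polynomial over a field whose simple roots are stable does
not change under small perturbations of the coefficients. -/
theorem StableSimpleRoots.eventually_adjoin_roots_eq {L Ω : Type*} [Field L] [TopologicalSpace L]
    [IsTopologicalRing L] [T1Space L] [Infinite L] (hL : StableSimpleRoots L) [Field Ω]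
    [Algebra L Ω] [Normal L Ω] {d : ℕ} {ι : Type*} {l : Filter ι} {g : ι → L[X]} {f : L[X]}
    {a : Fin d → Ω} {b : ι → Fin d → Ω}
    (hf : f.map (algebraMap L Ω) = ∏ j, (X - C (a j)))
    (hg : ∀ t, (g t).map (algebraMap L Ω) = ∏ j, (X - C (b t j)))
    (ha : Function.Injective a)
    (hlim : ∀ i, Tendsto (fun t => (g t).coeff i) l (𝓝 (f.coeff i))) :
    ∀ᶠ t in l, Function.Injective (b t) ∧
      IntermediateField.adjoin L (Set.range (b t)) = IntermediateField.adjoin L (Set.range a) := by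
  obtain ⟨ℓ, hℓ⟩ := exists_matchingSum_ne (L := L) ha
  have hinj := eventually_injective_roots hf hg ha hlim
  obtain ⟨R₀, hR₀⟩ := exists_map_eq_matchingResolvent ℓ hf ha hf ha
  have hR : ∀ t, ∃ R : L[X], Function.Injective (b t) →
      R.map (algebraMap L Ω) = matchingResolvent ℓ a (b t) := by
    intro t
    by_cases h : Function.Injective (b t)
    · obtain ⟨R, hR⟩ := exists_map_eq_matchingResolvent ℓ hf ha (hg t) h
      exact ⟨R, fun _ => hR⟩
    · exact ⟨0, fun h' => absurd h' h⟩
  choose R hR using hR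
  have hdeg : ∀ R : L[X], ∀ b : Fin d → Ω, R.map (algebraMap L Ω) = matchingResolvent ℓ a b →
      R.natDegree ≤ d.factorial := by
    intro R b h
    rw [← natDegree_map (algebraMap L Ω), h, natDegree_matchingResolvent]
  have hRlim : ∀ k, Tendsto (fun t => (R t).coeff k) l (𝓝 (R₀.coeff k)) := by
    intro k
    obtain ⟨P, hP, hPev⟩ := exists_isSymmetric_coeff_matchingResolvent ℓ a k
    obtain ⟨Ψ, hΨ, hΨev⟩ := exists_continuous_coeff_of_isSymmetric (L := L) hP
    rw [hΨev f a (R₀.coeff k) hf (by rw [hPev, ← hR₀, coeff_map])]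
    refine Tendsto.congr' ?_ ((hΨ.tendsto _).comp (tendsto_pi_nhds.2 fun i : Fin d => hlim i))
    filter_upwards [hinj] with t ht
    exact (hΨev (g t) (b t) _ (hg t) (by rw [hPev, ← hR t ht, coeff_map])).symm
  -- An automorphism permuting `a` by `α` sends the identity matching to $\alpha\cdot
  -- 1\cdot\alpha^{-1}=1$.
  obtain ⟨z₀, hz₀⟩ : matchingSum ℓ a a 1 ∈ (algebraMap L Ω).range := by
    refine IsSeparable.mem_range_algebraMap_of_forall_fixed ?_ fun σ => ?_
    · rw [← mem_separableClosure_iff]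
      refine sum_mem fun j _ => mul_mem ?_ (isSeparable_of_map_eq_prod hf ha j)
      have h := aeval_algHom_apply (separableClosure L Ω).val
        ⟨a j, isSeparable_of_map_eq_prod hf ha j⟩ ℓ
      rw [show aeval (a j) ℓ = _ from h]
      exact SetLike.coe_mem _
    · obtain ⟨α, hα⟩ := exists_perm_of_map_eq_prod hf ha σ
      have h := map_matchingSum (σ : Ω →ₐ[L] Ω) ℓ a a 1
      rw [show ((σ : Ω →ₐ[L] Ω) ∘ a) = a ∘ α from funext hα, matchingSum_comp, mul_one,
        mul_inv_cancel] at h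
      exact h
  have hroot : R₀.eval z₀ = 0 := by
    refine (algebraMap L Ω).injective ?_
    rw [map_zero, ← eval_map_apply, hR₀, hz₀, matchingResolvent, eval_prod]
    exact Finset.prod_eq_zero (Finset.mem_univ 1) (by simp)
  have hroot' : R₀.derivative.eval z₀ ≠ 0 := by
    intro h
    refine derivative_matchingResolvent_eval_ne_zero hℓ ?_
    rw [← hR₀, ← hz₀, derivative_map, eval_map_apply, h, map_zero]
  have hsimple := hL.eventually_exists_simple_root (hinj.mono fun t ht => hdeg (R t) _ (hR t ht))
    (hdeg _ _ hR₀) hRlim hroot hroot'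
  filter_upwards [hsimple, hinj] with t ⟨z, hz, hz'⟩ ht
  refine ⟨ht, adjoin_roots_eq_of_simple_root_matchingResolvent (ℓ := ℓ) (z := z) hf ha (hg t) ht
    ?_ ?_⟩
  · rw [← hR t ht, eval_map_apply, hz, map_zero]
  · rw [← hR t ht, derivative_map, eval_map_apply]
    exact fun h => hz' ((algebraMap L Ω).injective (by rw [h, map_zero]))

end Krasner

/-! ### Splitting fields and bounds on their automorphism groups -/

section SplittingFields

variable {L Ω : Type*} [Field L] [Field Ω] [Algebra L Ω] {d : ℕ} {f : L[X]} {a : Fin d → Ω}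

theorem isSplittingField_adjoin_of_map_eq_prod
    (hf : f.map (algebraMap L Ω) = ∏ j, (X - C (a j))) :
    f.IsSplittingField L (IntermediateField.adjoin L (Set.range a)) := by
  have hroots : f.rootSet Ω = Set.range a := by
    have hf0 : f ≠ 0 := by
      rintro rfl
      rw [Polynomial.map_zero] at hf
      exact (monic_prod_X_sub_C a Finset.univ).ne_zero hf.symm
    ext x
    rw [mem_rootSet_of_ne hf0, ← eval_map_algebraMap, hf, eval_prod, Finset.prod_eq_zero_iff]
    simp [sub_eq_zero, eq_comm]
  rw [← hroots]
  refine IntermediateField.adjoin_rootSet_isSplittingField ?_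
  rw [hf]
  exact Splits.prod fun j _ => Splits.X_sub_C _

theorem isGalois_adjoin_of_map_eq_prod (hf : f.map (algebraMap L Ω) = ∏ j, (X - C (a j)))
    (ha : Function.Injective a) : IsGalois L (IntermediateField.adjoin L (Set.range a)) := by
  have := isSplittingField_adjoin_of_map_eq_prod hf
  refine IsGalois.of_separable_splitting_field (p := f) ?_
  rw [← separable_map (algebraMap L Ω), hf]
  exact separable_prod_X_sub_C_iff.2 ha

/-- An automorphism of a splitting field is determined by its effect on the roots. -/
theorem card_aut_adjoin_le (hf : f.map (algebraMap L Ω) = ∏ j, (X - C (a j))) :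
    Nat.card (IntermediateField.adjoin L (Set.range a) ≃ₐ[L]
      IntermediateField.adjoin L (Set.range a)) ≤ d ^ d := by
  set M := IntermediateField.adjoin L (Set.range a) with hM
  let a' : Fin d → M := fun j => ⟨a j, IntermediateField.subset_adjoin L _ ⟨j, rfl⟩⟩
  have h : ∀ (σ : M ≃ₐ[L] M) (j : Fin d), ∃ k, σ (a' j) = a' k := by
    intro σ j
    have h1 : aeval (a' j) f = 0 := by
      have h0 : M.val (aeval (a' j) f) = 0 := by
        rw [← aeval_algHom_apply, ← eval_map_algebraMap, hf, eval_prod]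
        exact Finset.prod_eq_zero (Finset.mem_univ j) (by simp [a'])
      exact Subtype.ext h0
    have h2 : aeval (M.val (σ (a' j))) f = 0 := by
      rw [aeval_algHom_apply, aeval_algHom_apply, h1, map_zero, map_zero]
    rw [← eval_map_algebraMap, hf, eval_prod, Finset.prod_eq_zero_iff] at h2
    obtain ⟨k, -, hk⟩ := h2
    exact ⟨k, Subtype.ext (sub_eq_zero.1 (by simpa using hk))⟩
  choose F hF using h
  have hinj : Function.Injective F := by
    intro σ τ hστ
    have : (σ : M →ₐ[L] M) = τ := by
      refine IntermediateField.algHom_ext_of_eq_adjoin _ hM ?_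
      rintro _ ⟨j, rfl⟩
      exact (hF σ j).trans ((congrArg a' (congrFun hστ j)).trans (hF τ j).symm)
    exact AlgEquiv.coe_toAlgHom_injective this
  calc Nat.card (M ≃ₐ[L] M) ≤ Nat.card (Fin d → Fin d) := Nat.card_le_card_of_injective F hinj
    _ = d ^ d := by simp

end SplittingFields

/-! ### Finite étale algebras over a field and their fields of points -/

section EtaleAlgebra

open TensorProduct

variable (L : Type*) [Field L] (B : Type*) [CommRing B] [Algebra L B]
  (Ω : Type*) [Field Ω] [Algebra L Ω]

/-- The subfield of `Ω` generated by the images of an `L`-algebra `B` under all homomorphisms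
`B →ₐ[L] Ω`. -/
noncomputable def pointsField : IntermediateField L Ω :=
  IntermediateField.adjoin L (⋃ ψ : B →ₐ[L] Ω, Set.range ψ)

theorem charpoly_lmul_pi {d : ℕ} (v : Fin d → Ω) :
    (Algebra.lmul Ω (Fin d → Ω) v).charpoly = ∏ j, (X - C (v j)) := by
  rw [← LinearMap.charpoly_toMatrix _ (Pi.basisFun Ω (Fin d)), ← Matrix.charpoly_diagonal]
  congr 1
  ext i j
  simp [Matrix.diagonal_apply, Pi.single_apply]

variable {L B}

theorem AlgEquiv.charpoly_lmul {R S T : Type*} [CommRing R] [CommRing S] [CommRing T] [Algebra R S]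
    [Algebra R T] [Module.Finite R S] [Module.Free R S] [Module.Finite R T] [Module.Free R T]
    (e : S ≃ₐ[R] T) (x : S) :
    (Algebra.lmul R T (e x)).charpoly = (Algebra.lmul R S x).charpoly := by
  rw [← e.toLinearEquiv.charpoly_conj]
  congr 1
  ext y
  simp [LinearEquiv.conj_apply]

/-- The geometric points of a finite étale algebra, and the characteristic polynomials of its
elements. -/
theorem exists_charpoly_lmul_map_eq_prod [IsSepClosed Ω] [Module.Finite L B] [Algebra.Etale L B]
    {d : ℕ} (hd : Module.finrank L B = d) :
    ∃ φ : Fin d → B →ₐ[L] Ω, Function.Injective φ ∧ ∀ x : B,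
      (Algebra.lmul L B x).charpoly.map (algebraMap L Ω) = ∏ j, (X - C (φ j x)) := by
  let e₀ := Algebra.FormallyEtale.equivPiOfIsSepClosed Ω (Ω ⊗[L] B)
  have : IsArtinianRing (Ω ⊗[L] B) := isArtinian_of_tower Ω inferInstance
  have : Fintype (PrimeSpectrum (Ω ⊗[L] B)) := Fintype.ofFinite _
  have hcard : Fintype.card (PrimeSpectrum (Ω ⊗[L] B)) = d := by
    have h := e₀.toLinearEquiv.finrank_eq
    rw [Module.finrank_baseChange, hd, Module.finrank_fintype_fun_eq_card] at h
    exact h.symm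
  let e : Ω ⊗[L] B ≃ₐ[Ω] (Fin d → Ω) :=
    e₀.trans (AlgEquiv.piCongrLeft Ω (fun _ => Ω) (Fintype.equivFinOfCardEq hcard))
  let φ : Fin d → B →ₐ[L] Ω := fun j =>
    (((Pi.evalAlgHom Ω (fun _ : Fin d => Ω) j).comp (e : Ω ⊗[L] B →ₐ[Ω] _)).restrictScalars L).comp
      Algebra.TensorProduct.includeRight
  refine ⟨φ, fun i j hij => ?_, fun x => ?_⟩
  · have h : (Pi.evalAlgHom Ω (fun _ : Fin d => Ω) i).comp (e : Ω ⊗[L] B →ₐ[Ω] _) =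
        (Pi.evalAlgHom Ω (fun _ : Fin d => Ω) j).comp (e : Ω ⊗[L] B →ₐ[Ω] _) :=
      Algebra.TensorProduct.ext (Subsingleton.elim _ _) hij
    by_contra hne
    have := DFunLike.congr_fun h (e.symm (Pi.single i 1))
    simp [Ne.symm hne] at this
  · rw [← LinearMap.charpoly_baseChange, Algebra.baseChange_lmul, ← AlgEquiv.charpoly_lmul e,
      charpoly_lmul_pi]
    rfl

theorem exists_injective_apply [Infinite L] {d : ℕ} {φ : Fin d → B →ₐ[L] Ω}
    (hφ : Function.Injective φ) : ∃ x : B, Function.Injective fun j => φ j x := by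
  by_contra! hc
  let I := {p : Fin d × Fin d // p.1 ≠ p.2}
  have hcov : ⋃ p : I, ((LinearMap.ker ((φ p.1.1).toLinearMap - (φ p.1.2).toLinearMap) :
      Subspace L B) : Set B) = Set.univ := by
    refine Set.eq_univ_of_forall fun x => ?_
    have := hc x
    simp only [Function.Injective, not_forall] at this
    obtain ⟨i, j, hij, hne⟩ := this
    exact Set.mem_iUnion.2 ⟨⟨(i, j), hne⟩, by simpa [sub_eq_zero] using hij⟩
  obtain ⟨⟨⟨i, j⟩, hne⟩, h⟩ := Subspace.exists_eq_top_of_iUnion_eq_univ hcov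
  refine hne (hφ (AlgHom.ext fun x => ?_))
  have := LinearMap.congr_fun (LinearMap.ker_eq_top.1 h) x
  simpa [sub_eq_zero] using this

/-- An element which takes distinct values at the geometric points generates the algebra, hence its
values generate the field of points. -/
theorem pointsField_eq_adjoin_range [Module.Finite L B] {d : ℕ} (hd : Module.finrank L B = d)
    {φ : Fin d → B →ₐ[L] Ω} {x : B} (hx : Function.Injective fun j => φ j x)
    (hchar : (Algebra.lmul L B x).charpoly.map (algebraMap L Ω) = ∏ j, (X - C (φ j x))) :
    pointsField L B Ω = IntermediateField.adjoin L (Set.range fun j => φ j x) := by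
  refine le_antisymm ?_ ?_
  · rw [pointsField, IntermediateField.adjoin_le_iff]
    refine Set.iUnion_subset fun ψ => ?_
    rintro _ ⟨y, rfl⟩
    -- By Vandermonde, the powers of `x` form a basis. By Cayley–Hamilton `ψ x` is a root of the
    -- characteristic polynomial, hence some `φ j x`, so all values of `ψ` lie in the adjoined
    -- field.
    have hli : LinearIndependent L fun i : Fin d => x ^ (i : ℕ) := by
      rw [Fintype.linearIndependent_iff]
      intro c hc
      have h := Matrix.eq_zero_of_forall_index_sum_mul_pow_eq_zero
        (v := fun i => algebraMap L Ω (c i)) hx fun j => by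
          have := congrArg (φ j) hc
          simpa [Algebra.smul_def] using this
      intro i
      simpa using congrFun h i
    have hspan := hli.span_eq_top_of_card_eq_finrank' (by rw [Fintype.card_fin, hd])
    have hψx : ∃ j, ψ x = φ j x := by
      have h1 : aeval x (Algebra.lmul L B x).charpoly = 0 := by
        have h := LinearMap.congr_fun (LinearMap.aeval_self_charpoly (Algebra.lmul L B x)) 1
        rw [aeval_algHom_apply] at h
        simpa using h
      have h2 : aeval (ψ x) (Algebra.lmul L B x).charpoly = 0 := by
        rw [aeval_algHom_apply, h1, map_zero]
      rw [← eval_map_algebraMap, hchar, eval_prod, Finset.prod_eq_zero_iff] at h2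
      obtain ⟨j, -, hj⟩ := h2
      exact ⟨j, by simpa [sub_eq_zero] using hj⟩
    obtain ⟨j, hj⟩ := hψx
    have hmem : ψ x ∈ IntermediateField.adjoin L (Set.range fun j => φ j x) := by
      rw [hj]
      exact IntermediateField.subset_adjoin L _ ⟨j, rfl⟩
    have hy : y ∈ Submodule.span L (Set.range fun i : Fin d => x ^ (i : ℕ)) := by
      rw [hspan]
      trivial
    induction hy using Submodule.span_induction with
    | mem z hz =>
      obtain ⟨i, rfl⟩ := hz
      simpa using pow_mem hmem _
    | zero => simp
    | add z w _ _ hz hw => simpa using add_mem hz hw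
    | smul c z _ hz => simpa using IntermediateField.smul_mem _ hz
  · rw [IntermediateField.adjoin_le_iff]
    rintro _ ⟨j, rfl⟩
    exact IntermediateField.subset_adjoin L _ (Set.mem_iUnion.2 ⟨φ j, x, rfl⟩)

/-- The field of points of a finite étale algebra is a finite Galois extension, of degree bounded in
terms of the rank. -/
theorem isGalois_pointsField [Infinite L] [IsSepClosed Ω] [Module.Finite L B] [Algebra.Etale L B]
    {d : ℕ} (hd : Module.finrank L B = d) :
    FiniteDimensional L (pointsField L B Ω) ∧ IsGalois L (pointsField L B Ω) ∧
      Nat.card (pointsField L B Ω ≃ₐ[L] pointsField L B Ω) ≤ d ^ d := by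
  obtain ⟨φ, hφ, hchar⟩ := exists_charpoly_lmul_map_eq_prod (Ω := Ω) hd
  obtain ⟨x, hx⟩ := exists_injective_apply Ω hφ
  rw [pointsField_eq_adjoin_range Ω hd hx (hchar x)]
  have := isSplittingField_adjoin_of_map_eq_prod (hchar x)
  exact ⟨IsSplittingField.finiteDimensional _ (Algebra.lmul L B x).charpoly,
    isGalois_adjoin_of_map_eq_prod (hchar x) hx, card_aut_adjoin_le (hchar x)⟩

theorem continuous_charpoly_coeff {R n : Type*} [CommRing R] [TopologicalSpace R]
    [IsTopologicalRing R] [Fintype n] [DecidableEq n] (k : ℕ) :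
    Continuous fun M : Matrix n n R => M.charpoly.coeff k := by
  have h : (fun M : Matrix n n R => M.charpoly.coeff k) = fun M =>
      MvPolynomial.eval (fun q : n × n => M q.1 q.2) ((Matrix.charpoly.univ R n).coeff k) := by
    ext M
    exact (Matrix.charpoly.univ_coeff_eval₂Hom n (RingHom.id R) (fun q : n × n => M q.1 q.2) k).symm
  rw [h]
  refine (MvPolynomial.continuous_eval _).comp (continuous_pi fun q => ?_)
  exact continuous_id.matrix_elem _ _

/-- In a family of finite étale algebras with continuously varying structure constants, the field of
points is locally constant. -/
theorem StableSimpleRoots.eventually_pointsField_eq [TopologicalSpace L] [IsTopologicalRing L]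
    [T1Space L] [Infinite L] (hL : StableSimpleRoots L) [IsSepClosed Ω] [Normal L Ω]
    {ι : Type*} {l : Filter ι} (A : ι → Type*) [∀ t, CommRing (A t)] [∀ t, Algebra L (A t)]
    [∀ t, Algebra.Etale L (A t)] {d : ℕ} (e : ∀ t, Module.Basis (Fin d) L (A t)) (t₀ : ι)
    (hlim : ∀ i j k, Tendsto (fun t => Algebra.leftMulMatrix (e t) (e t i) j k) l
      (𝓝 (Algebra.leftMulMatrix (e t₀) (e t₀ i) j k))) :
    ∀ᶠ t in l, pointsField L (A t) Ω = pointsField L (A t₀) Ω := by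
  have hfin : ∀ t, Module.Finite L (A t) := fun t => .of_basis (e t)
  have hd : ∀ t, Module.finrank L (A t) = d := fun t => by
    rw [Module.finrank_eq_card_basis (e t), Fintype.card_fin]
  choose φ hφ hchar using fun t => exists_charpoly_lmul_map_eq_prod (Ω := Ω) (hd t)
  obtain ⟨x₀, hx₀⟩ := exists_injective_apply Ω (hφ t₀)
  -- The element with the same coordinates in every algebra; its multiplication matrix varies
  -- continuously with the structure constants.
  let x : ∀ t, A t := fun t => ∑ i, (e t₀).repr x₀ i • e t i
  have hx : x t₀ = x₀ := (e t₀).sum_repr x₀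
  have hmat : Tendsto (fun t => Algebra.leftMulMatrix (e t) (x t)) l
      (𝓝 (Algebra.leftMulMatrix (e t₀) (x t₀))) := by
    simp only [x, map_sum, map_smul]
    refine tendsto_finsetSum _ fun i _ => Tendsto.const_smul ?_ _
    exact tendsto_pi_nhds.2 fun j => tendsto_pi_nhds.2 fun k => hlim i j k
  have hcoeff : ∀ k, Tendsto (fun t => (Algebra.lmul L (A t) (x t)).charpoly.coeff k) l
      (𝓝 ((Algebra.lmul L (A t₀) (x t₀)).charpoly.coeff k)) := by
    intro k
    have h : ∀ t, (Algebra.lmul L (A t) (x t)).charpoly =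
        (Algebra.leftMulMatrix (e t) (x t)).charpoly := fun t => by
      rw [← LinearMap.charpoly_toMatrix _ (e t)]
      rfl
    simp only [h]
    exact ((continuous_charpoly_coeff k).tendsto _).comp hmat
  have key := hL.eventually_adjoin_roots_eq (hchar t₀ (x t₀)) (fun t => hchar t (x t))
    (by rw [hx]; exact hx₀) hcoeff
  filter_upwards [key] with t ⟨ht, ht'⟩
  rw [pointsField_eq_adjoin_range Ω (hd t) ht (hchar t (x t)), ht',
    pointsField_eq_adjoin_range Ω (hd t₀) (by rw [hx]; exact hx₀) (hchar t₀ (x t₀))]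

end EtaleAlgebra

/-! ### From points of schemes to algebra homomorphisms -/

section FieldOfPoints

theorem evalAt_comp {L : Type u} [Field L] {U V : Scheme.{u}} (t : Spec (.of L) ⟶ U) (g : U ⟶ V)
    (f : Γ(V, ⊤)) : evalAt (t ≫ g) f = evalAt t (g.appTop.hom f) := by
  rw [evalAt, evalAt, Scheme.Hom.comp_appTop, CommRingCat.hom_comp, RingHom.comp_apply]

theorem evalAt_specMap {L : Type u} [Field L] {R : CommRingCat.{u}} (φ : R ⟶ .of L)
    (f : Γ(Spec R, ⊤)) :
    evalAt (Spec.map φ) f = φ.hom ((Scheme.ΓSpecIso R).hom.hom f) := by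
  have h := Scheme.ΓSpecIso_naturality φ
  exact congrArg (fun g => g.hom f) h

theorem evalAt_mem_range {Ω : Type u} [Field Ω] {X : Scheme.{u}}
    (x : Spec (.of Ω) ⟶ X) (g : Γ(X, ⊤)) :
    evalAt x g ∈ Set.range (Scheme.SpecToEquivOfField Ω X x).2.hom := by
  have h := (Scheme.SpecToEquivOfField Ω X).symm_apply_apply x
  rw [Scheme.SpecToEquivOfField_symm_apply] at h
  rw [← congrArg (fun z => evalAt z g) h, evalAt_comp, evalAt_specMap]
  exact ⟨_, rfl⟩

/-- If an `Ω`-point of `X` comes from an `F`-point, then so does the embedding of its residue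
field. -/
theorem range_specToEquivOfField_comp_subset {F Ω : Type u} [Field F] [Field Ω] {X : Scheme.{u}}
    (i : F →+* Ω) (y : Spec (.of F) ⟶ X) :
    Set.range (Scheme.SpecToEquivOfField Ω X (Spec.map (CommRingCat.ofHom i) ≫ y)).2.hom ⊆
      Set.range i := by
  have h := (Scheme.SpecToEquivOfField F X).symm_apply_apply y
  rw [Scheme.SpecToEquivOfField_symm_apply] at h
  have h' : Spec.map (CommRingCat.ofHom i) ≫ y = (Scheme.SpecToEquivOfField Ω X).symm
      ⟨_, (Scheme.SpecToEquivOfField F X y).2 ≫ CommRingCat.ofHom i⟩ := by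
    rw [Scheme.SpecToEquivOfField_symm_apply, Spec.map_comp, Category.assoc, h]
  rw [h', Equiv.apply_symm_apply]
  rintro _ ⟨z, rfl⟩
  exact ⟨_, rfl⟩

/-- The field generated by the points of an affine `L`-scheme `Spec B`. -/
theorem fieldOfPoints_eq_pointsField {L : Type u} [Field L] {B : Type u} [CommRing B] [Algebra L B]
    {X : Scheme.{u}} (q : X ⟶ Spec (.of L)) (i : X ≅ Spec (.of B))
    (hi : i.hom ≫ Spec.map (CommRingCat.ofHom (algebraMap L B)) = q)
    (Ω : Type u) [Field Ω] [Algebra L Ω] : fieldOfPoints q Ω = pointsField L B Ω := by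
  refine le_antisymm ?_ ?_
  · rw [fieldOfPoints, IntermediateField.adjoin_le_iff]
    refine Set.iUnion_subset fun ⟨x, hx⟩ => ?_
    let ψ : CommRingCat.of B ⟶ CommRingCat.of Ω := Spec.preimage (x ≫ i.hom)
    have hψ : Spec.map ψ = x ≫ i.hom := Spec.map_preimage _
    have hψL : ψ.hom.comp (algebraMap L B) = algebraMap L Ω := by
      have h : CommRingCat.ofHom (algebraMap L B) ≫ ψ = CommRingCat.ofHom (algebraMap L Ω) := by
        apply Spec.map_injective
        rw [Spec.map_comp, hψ, Category.assoc, hi, hx]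
      exact congrArg CommRingCat.Hom.hom h
    let ψ' : B →ₐ[L] Ω := { ψ.hom with commutes' := fun c => RingHom.congr_fun hψL c }
    have hmem : ∀ b, ψ' b ∈ pointsField L B Ω := fun b =>
      IntermediateField.subset_adjoin L _ (Set.mem_iUnion.2 ⟨ψ', b, rfl⟩)
    let ψF : B →+* pointsField L B Ω :=
      (ψ'.codRestrict (pointsField L B Ω).toSubalgebra hmem).toRingHom
    -- The point already factors through the spectrum of the field of points, so its whole residue
    -- field, not just the image of `B`, embeds there.
    have hxF : x = Spec.map (CommRingCat.ofHom (algebraMap (pointsField L B Ω) Ω)) ≫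
        (Spec.map (CommRingCat.ofHom ψF) ≫ i.inv) := by
      rw [← Category.assoc, ← Spec.map_comp, ← CommRingCat.ofHom_comp, Iso.eq_comp_inv, ← hψ]
      rfl
    change Set.range (Scheme.SpecToEquivOfField Ω X x).2.hom ⊆ _
    rw [hxF]
    refine (range_specToEquivOfField_comp_subset _ _).trans ?_
    rintro _ ⟨z, rfl⟩
    exact z.2
  · rw [pointsField, IntermediateField.adjoin_le_iff]
    refine Set.iUnion_subset fun ψ => ?_
    rintro _ ⟨b, rfl⟩
    let x : KPoints q Ω := ⟨Spec.map (CommRingCat.ofHom (ψ : B →+* Ω)) ≫ i.inv, by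
      rw [Category.assoc, ← hi, Iso.inv_hom_id_assoc, ← Spec.map_comp, ← CommRingCat.ofHom_comp,
        AlgHom.comp_algebraMap]⟩
    refine IntermediateField.subset_adjoin L _ (Set.mem_iUnion.2 ⟨x, ?_⟩)
    have h := evalAt_mem_range x.1 (i.hom.appTop.hom ((Scheme.ΓSpecIso (.of B)).inv.hom b))
    rw [← evalAt_comp, Category.assoc, Iso.inv_hom_id, Category.comp_id, evalAt_specMap] at h
    convert h using 1
    simp

end FieldOfPoints

/-! ### Fibres over affine charts and the analytic topology -/

section Charts

open TensorProduct

/-- The base change of an `R`-algebra along a homomorphism `t : R →+* L`. -/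
def FibreAlgebra {R L : Type u} [CommRing R] [CommRing L] (t : R →+* L) (R' : Type u) [CommRing R']
    [Algebra R R'] : Type u :=
  @TensorProduct R _ L R' _ _ t.toAlgebra.toModule _

namespace FibreAlgebra

variable {R L : Type u} [CommRing R] [CommRing L] (t : R →+* L) (R' : Type u) [CommRing R']
    [Algebra R R']

noncomputable instance : CommRing (FibreAlgebra t R') :=
  @Algebra.TensorProduct.instCommRing R L R' _ _ t.toAlgebra _ _

noncomputable instance : Algebra L (FibreAlgebra t R') :=
  letI := t.toAlgebra
  (inferInstance : Algebra L (L ⊗[R] R'))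

instance [Algebra.Etale R R'] : Algebra.Etale L (FibreAlgebra t R') := by
  let := t.toAlgebra
  have : Algebra.Etale L (L ⊗[R] R') := inferInstance
  exact this

/-- The basis of a fibre induced by a basis of the algebra. -/
noncomputable def basis {ι : Type*} (e : Module.Basis ι R R') :
    Module.Basis ι L (FibreAlgebra t R') :=
  letI := t.toAlgebra
  e.baseChange L

-- The structure constants of a fibre are values at `t` of fixed regular functions on the chart,
-- which is why they vary continuously.
variable {R'} in
theorem leftMulMatrix_basis {ι : Type*} [Fintype ι] [DecidableEq ι] (e : Module.Basis ι R R')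
    (i j k : ι) : Algebra.leftMulMatrix (basis t R' e) (basis t R' e i) j k =
      t (Algebra.leftMulMatrix e (e i) j k) := by
  let := t.toAlgebra
  change Algebra.leftMulMatrix (e.baseChange L) (e.baseChange L i) j k = _
  rw [Algebra.leftMulMatrix_eq_repr_mul, Algebra.leftMulMatrix_eq_repr_mul]
  simp only [Module.Basis.baseChange_apply, Algebra.TensorProduct.tmul_mul_tmul, mul_one,
    Module.Basis.baseChange_repr_tmul]
  rw [Algebra.smul_def, mul_one]
  rfl

theorem isPullback : ∃ g : Spec (.of (FibreAlgebra t R')) ⟶ Spec (.of R'),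
    IsPullback g (Spec.map (CommRingCat.ofHom (algebraMap L (FibreAlgebra t R'))))
      (Spec.map (CommRingCat.ofHom (algebraMap R R'))) (Spec.map (CommRingCat.ofHom t)) := by
  let := t.toAlgebra
  exact ⟨_, (isPullback_SpecMap_of_isPushout _ _ _ _
    (CommRingCat.isPushout_tensorProduct R L R')).flip⟩

end FibreAlgebra

variable {K : Type u} [Field K] {S S' : Scheme.{u}} {p : S ⟶ Spec (.of K)} {f : S' ⟶ S}
  {L : Type u} [Field L] [Algebra K L] {R R' : Type u} [CommRing R] [CommRing R'] [Algebra R R']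
  {j : Spec (.of R) ⟶ S} {i : Spec (.of R') ⟶ S'}

theorem fibreField_eq_pointsField
    (h : IsPullback i (Spec.map (CommRingCat.ofHom (algebraMap R R'))) f j) (s : KPoints p L)
    (t : R →+* L) (hst : Spec.map (CommRingCat.ofHom t) ≫ j = s.1)
    (Ω : Type u) [Field Ω] [Algebra L Ω] :
    fibreField f s Ω = pointsField L (FibreAlgebra t R') Ω := by
  obtain ⟨g, hg⟩ := FibreAlgebra.isPullback t R'
  have hpaste := hg.paste_horiz h
  rw [hst] at hpaste
  exact fieldOfPoints_eq_pointsField _ hpaste.isoPullback.symm hpaste.isoPullback_inv_snd Ω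

/-- The points of a chart at which a given function takes its value in a given open set form an open
set. -/
theorem isOpen_setOf_chart [TopologicalSpace L] [IsOpenImmersion j] (c : R) {V : Set L}
    (hV : IsOpen V) :
    IsOpen {s : KPoints p L |
      ∃ t : R →+* L, Spec.map (CommRingCat.ofHom t) ≫ j = s.1 ∧ t c ∈ V} := by
  refine TopologicalSpace.isOpen_generateFrom_of_mem ⟨j.opensRange, isAffineOpen_opensRange j,
    j.isoOpensRange.inv.appTop.hom ((Scheme.ΓSpecIso (.of R)).inv.hom c), V, hV, ?_⟩
  ext s
  constructor
  · rintro ⟨t, ht, htc⟩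
    refine ⟨Spec.map (CommRingCat.ofHom t) ≫ j.isoOpensRange.hom, by simpa using ht, ?_⟩
    rw [← evalAt_comp, Category.assoc, Iso.hom_inv_id, Category.comp_id, evalAt_specMap]
    simpa [← CommRingCat.comp_apply] using htc
  · rintro ⟨t', ht', htc⟩
    have hpre : Spec.map (Spec.preimage (t' ≫ j.isoOpensRange.inv)) = t' ≫ j.isoOpensRange.inv :=
      Spec.map_preimage _
    refine ⟨(Spec.preimage (t' ≫ j.isoOpensRange.inv)).hom, ?_, ?_⟩
    · rw [CommRingCat.ofHom_hom, hpre, ← ht', Category.assoc]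
      simp
    · rw [← evalAt_comp, ← hpre, evalAt_specMap] at htc
      simpa [← CommRingCat.comp_apply] using htc

end Charts

/-! ### Local freeness of finite étale covers -/

section FreeCharts

open TensorProduct

/-- A finite étale algebra is free near any given prime. -/
theorem exists_basis_localizationAway {A A' : Type u} [CommRing A] [CommRing A'] [Algebra A A']
    [Module.Finite A A'] [Algebra.Etale A A'] (q : PrimeSpectrum A) :
    ∃ r ∉ q.asIdeal, ∃ d : ℕ, Nonempty
      (Module.Basis (Fin d) (Localization.Away r) (Localization.Away r ⊗[A] A')) := by
  have : Module.FinitePresentation A A' :=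
    Module.FinitePresentation.of_finite_of_finitePresentation A A'
  -- Flat and finitely presented modules are free at every prime; this freeness then spreads out to
  -- a basic open set.
  have hq : q ∈ Module.freeLocus A A' := by
    rw [Module.freeLocus_eq_univ]
    trivial
  have : Module.Free _ _ := hq
  obtain ⟨r, hr, hfree, -⟩ := Module.FinitePresentation.exists_free_localizedModule_powers
    q.asIdeal.primeCompl (LocalizedModule.mkLinearMap q.asIdeal.primeCompl A')
    (Localization.AtPrime q.asIdeal)
  have hfree' : Module.Free (Localization.Away r) (Localization.Away r ⊗[A] A') :=
    Module.Free.of_equiv (LocalizedModule.equivTensorProduct (Submonoid.powers r) A')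
  exact ⟨r, hr, _, ⟨(Module.Free.chooseBasis (Localization.Away r)
    (Localization.Away r ⊗[A] A')).reindex (Fintype.equivFin _)⟩⟩

/-- A finite étale cover is, locally on the base, given by a finite free étale algebra. -/
theorem exists_free_chart {S S' : Scheme.{u}} (f : S' ⟶ S) [IsFinite f] [Etale f] (x : S) :
    ∃ (R R' : Type u) (_ : CommRing R) (_ : CommRing R') (_ : Algebra R R')
      (_ : Algebra.Etale R R') (d : ℕ) (_ : Module.Basis (Fin d) R R')
      (j : Spec (.of R) ⟶ S) (_ : IsOpenImmersion j) (i : Spec (.of R') ⟶ S'),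
      x ∈ j.opensRange ∧ IsPullback i (Spec.map (CommRingCat.ofHom (algebraMap R R'))) f j := by
  obtain ⟨W, hW, hxW, -⟩ := exists_isAffineOpen_mem_and_subset (X := S) (x := x) (U := ⊤) trivial
  have hW' : IsAffineOpen (f ⁻¹ᵁ W) := hW.preimage f
  let : Algebra Γ(S, W) Γ(S', f ⁻¹ᵁ W) := (f.app W).hom.toAlgebra
  have : Module.Finite Γ(S, W) Γ(S', f ⁻¹ᵁ W) := f.finite_app W hW
  have : Algebra.Etale Γ(S, W) Γ(S', f ⁻¹ᵁ W) := by
    have h := f.etale_appLE hW hW' le_rfl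
    rw [Scheme.Hom.appLE_eq_app] at h
    exact h
  obtain ⟨q, hq⟩ : x ∈ Set.range hW.fromSpec := by rwa [hW.range_fromSpec]
  obtain ⟨r, hr, d, ⟨e⟩⟩ := exists_basis_localizationAway (A' := Γ(S', f ⁻¹ᵁ W)) q
  let loc := Spec.map (CommRingCat.ofHom (algebraMap Γ(S, W) (Localization.Away r)))
  have hloc : IsOpenImmersion loc := IsOpenImmersion.of_isLocalization r
  have h1 : IsPullback hW'.fromSpec (Spec.map (f.app W)) f hW.fromSpec := by
    refine (IsOpenImmersion.isPullback _ _ _ _ ?_ ?_).flip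
    · have := IsAffineOpen.SpecMap_appLE_fromSpec f hW hW' le_rfl
      rw [Scheme.Hom.appLE_eq_app] at this
      exact this.symm
    · rw [hW.opensRange_fromSpec, hW'.opensRange_fromSpec]
  have h2 := isPullback_SpecMap_of_isPushout _ _ _ _
    (CommRingCat.isPushout_tensorProduct Γ(S, W) (Localization.Away r) Γ(S', f ⁻¹ᵁ W))
  refine ⟨Localization.Away r, Localization.Away r ⊗[Γ(S, W)] Γ(S', f ⁻¹ᵁ W), inferInstance,
    inferInstance, inferInstance, inferInstance, d, e, loc ≫ hW.fromSpec, inferInstance, _, ?_,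
    h2.flip.paste_horiz h1⟩
  have hq' : q ∈ Set.range loc := by
    change q ∈ Set.range (PrimeSpectrum.comap (algebraMap Γ(S, W) (Localization.Away r)))
    rw [PrimeSpectrum.localization_away_comap_range _ r]
    exact hr
  obtain ⟨y, hy⟩ := hq'
  exact ⟨y, by rw [← hq, ← hy]; rfl⟩

end FreeCharts

/-! ### Local constancy of the fibre field -/

section LocalConstancy

variable {K : Type u} [Field K] {S S' : Scheme.{u}} {p : S ⟶ Spec (.of K)}
  {L : Type u} [Field L] [Algebra K L]

/-- A point of `S` whose support lies in a chart comes from a homomorphism of the coordinate ring of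
the chart. -/
theorem exists_ringHom_of_mem_opensRange {R : Type u} [CommRing R] {j : Spec (.of R) ⟶ S}
    [IsOpenImmersion j] (s : Spec (.of L) ⟶ S) (hs : s (IsLocalRing.closedPoint L) ∈ j.opensRange) :
    ∃ t : R →+* L, Spec.map (CommRingCat.ofHom t) ≫ j = s := by
  have hrange : Set.range s ⊆ Set.range j := by
    rintro _ ⟨y, rfl⟩
    have : y = IsLocalRing.closedPoint L := Subsingleton.elim (α := PrimeSpectrum L) _ _
    rw [this]
    exact hs
  refine ⟨(Spec.preimage (IsOpenImmersion.lift j s hrange)).hom, ?_⟩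
  rw [CommRingCat.ofHom_hom, Spec.map_preimage, IsOpenImmersion.lift_fac]

/-- Near any point of the base the field generated by the fibre is finite Galois of bounded degree,
and locally constant for the analytic topology. -/
theorem exists_opens_fibreField (f : S' ⟶ S) [IsFinite f] [Etale f] [TopologicalSpace L]
    [IsTopologicalRing L] [T1Space L] [Infinite L] (hL : StableSimpleRoots L)
    (Ω : Type u) [Field Ω] [Algebra L Ω] [IsAlgClosure L Ω] (x : S) :
    ∃ W : S.Opens, x ∈ W ∧ ∃ N : ℕ, ∀ s : KPoints p L, s.1 (IsLocalRing.closedPoint L) ∈ W →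
      FiniteDimensional L (fibreField f s Ω) ∧ IsGalois L (fibreField f s Ω) ∧
      Nat.card (fibreField f s Ω ≃ₐ[L] fibreField f s Ω) ≤ N ∧
      ∀ᶠ s' in 𝓝 s, fibreField f s' Ω = fibreField f s Ω := by
  have : IsAlgClosed Ω := IsAlgClosure.isAlgClosed L
  have : Normal L Ω := IsAlgClosure.normal L Ω
  obtain ⟨R, R', _, _, _, _, d, e, j, _, i, hx, hpb⟩ := exists_free_chart f x
  refine ⟨j.opensRange, hx, d ^ d, fun s hs => ?_⟩
  obtain ⟨t, ht⟩ := exists_ringHom_of_mem_opensRange s.1 hs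
  have hfin : Module.Finite L (FibreAlgebra t R') := .of_basis (FibreAlgebra.basis t R' e)
  have hrank : Module.finrank L (FibreAlgebra t R') = d := by
    rw [Module.finrank_eq_card_basis (FibreAlgebra.basis t R' e), Fintype.card_fin]
  obtain ⟨h1, h2, h3⟩ := isGalois_pointsField (L := L) Ω hrank
  have hfield := fibreField_eq_pointsField (p := p) hpb s t ht Ω
  rw [hfield]
  refine ⟨h1, h2, h3, ?_⟩
  -- The family must be indexed by all of $S(L)$: in the chart `τ s'` is the unique homomorphism
  -- giving `s'`, elsewhere it is the irrelevant default `t`.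
  have hτ : ∀ s' : KPoints p L, ∃ t' : R →+* L,
      ∀ t'' : R →+* L, Spec.map (CommRingCat.ofHom t'') ≫ j = s'.1 → t' = t'' := by
    intro s'
    by_cases h : ∃ t'' : R →+* L, Spec.map (CommRingCat.ofHom t'') ≫ j = s'.1
    · obtain ⟨t', ht'⟩ := h
      refine ⟨t', fun t'' ht'' => ?_⟩
      have := Spec.map_injective ((cancel_mono j).1 (ht'.trans ht''.symm))
      exact congrArg CommRingCat.Hom.hom this
    · exact ⟨t, fun t'' ht'' => absurd ⟨t'', ht''⟩ h⟩
  choose τ hτ using hτ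
  have hlim : ∀ c : R, Tendsto (fun s' => τ s' c) (𝓝 s) (𝓝 (τ s c)) := by
    intro c
    rw [tendsto_nhds]
    intro V hV hcV
    rw [hτ s t ht] at hcV
    filter_upwards [(isOpen_setOf_chart (p := p) (j := j) c hV).mem_nhds ⟨t, ht, hcV⟩]
      with s' ⟨t', ht', hc'⟩
    rw [Set.mem_preimage, hτ s' t' ht']
    exact hc'
  have hconst := hL.eventually_pointsField_eq Ω (fun s' => FibreAlgebra (τ s') R')
    (fun s' => FibreAlgebra.basis (τ s') R' e) s (l := 𝓝 s) fun a b c => by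
      simp only [FibreAlgebra.leftMulMatrix_basis]
      exact hlim _
  -- With the function 0 and `V` everything, this says that the $L$-points of the chart form an open
  -- set.
  filter_upwards [hconst, (isOpen_setOf_chart (p := p) (L := L) (j := j) 0 isOpen_univ).mem_nhds
    ⟨t, ht, trivial⟩] with s' hs' ⟨t', ht', _⟩
  rw [hτ s' t' ht', hτ s t ht] at hs'
  rw [fibreField_eq_pointsField hpb s' t' ht' Ω, hs']

end LocalConstancy

/-! ### Finitely many groups of bounded order -/

section FiniteGroups

/-- There are finitely many groups of bounded order, up to isomorphism. -/
theorem exists_group_representatives (N : ℕ) :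
    ∃ (n : ℕ) (H : Fin n → Type) (_ : ∀ i, Group (H i)), (∀ i, Finite (H i)) ∧
      (∀ i j, Nonempty (H i ≃* H j) → i = j) ∧
      ∀ (G : Type u) [Group G] [Finite G], Nat.card G ≤ N → ∃ i, Nonempty (G ≃* H i) := by
  -- By Cayley, every group of order at most `N` embeds in the symmetric group on `N` letters.
  -- Classes of larger subgroups also occur and are harmless.
  let r : Setoid (Subgroup (Equiv.Perm (Fin N))) :=
    { r := fun A B => Nonempty (A ≃* B)
      iseqv := ⟨fun _ => ⟨MulEquiv.refl _⟩, fun ⟨e⟩ => ⟨e.symm⟩, fun ⟨e⟩ ⟨e'⟩ => ⟨e.trans e'⟩⟩ }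
  obtain ⟨n, ⟨k⟩⟩ := Finite.exists_equiv_fin (_root_.Quotient r)
  refine ⟨n, fun i => (k.symm i).out, fun i => inferInstance, fun i => inferInstance,
    fun i j h => ?_, fun G _ _ hG => ?_⟩
  · have h' : (_root_.Quotient.mk r (k.symm i).out) = _root_.Quotient.mk r (k.symm j).out :=
      _root_.Quotient.sound h
    rw [_root_.Quotient.out_eq, _root_.Quotient.out_eq] at h'
    exact k.symm.injective h'
  · let ι : G ↪ Fin N := (Finite.equivFin G).toEmbedding.trans (Fin.castLEEmb hG)
    let φ : G →* Equiv.Perm (Fin N) :=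
      (Equiv.Perm.viaEmbeddingHom ι).comp (MulAction.toPermHom G G)
    have hφ : Function.Injective φ :=
      (Equiv.Perm.viaEmbeddingHom_injective ι).comp MulAction.toPerm_injective
    obtain ⟨e⟩ : r (k.symm (k (_root_.Quotient.mk r φ.range))).out φ.range := by
      rw [Equiv.symm_apply_apply]
      exact _root_.Quotient.mk_out φ.range
    exact ⟨k (_root_.Quotient.mk r φ.range), ⟨(MonoidHom.ofInjective hφ).trans e.symm⟩⟩

end FiniteGroups

/-! ### Assembly of the main theorem -/

theorem mainTheorem5 {K : Type u} [Field K] {S S' : Scheme.{u}}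
    (p : S ⟶ Spec (.of K)) [LocallyOfFiniteType p] [QuasiCompact p]
    (f : S' ⟶ S) [IsFinite f] [Etale f]
    (L : Type u) [NontriviallyNormedField L] (hL : IsLocalField L) [Algebra K L]
    (Lbar : Type u) [Field Lbar] [Algebra L Lbar] [IsAlgClosure L Lbar] :
    (∀ s : KPoints p L,
      FiniteDimensional L (fibreField f s Lbar) ∧ IsGalois L (fibreField f s Lbar)) ∧
    ∃ (n : ℕ) (H : Fin n → Type) (_ : ∀ i, Group (H i)) (_ : ∀ i, Finite (H i))
      (U : Fin n → Set (KPoints p L)),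
      (∀ i, IsOpen (U i)) ∧
      (⋃ i, U i) = Set.univ ∧
      (∀ i j, i ≠ j → Disjoint (U i) (U j)) ∧
      ∀ (i : Fin n) (s : KPoints p L),
        s ∈ U i ↔ Nonempty ((fibreField f s Lbar ≃ₐ[L] fibreField f s Lbar) ≃* H i) := by
  have : Infinite L := NontriviallyNormedField.infinite L
  choose W hxW N hW using
    exists_opens_fibreField (p := p) f hL.stableSimpleRoots Lbar
  have hcomp : CompactSpace S := by
    have : CompactSpace (Spec (.of K)) := inferInstance
    exact QuasiCompact.compactSpace_of_compactSpace p
  obtain ⟨F, hF⟩ := isCompact_univ.elim_finite_subcover (fun x => (W x : Set S))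
    (fun x => (W x).isOpen) fun x _ => Set.mem_iUnion.2 ⟨x, hxW x⟩
  have hbound : ∀ s : KPoints p L,
      Nat.card (fibreField f s Lbar ≃ₐ[L] fibreField f s Lbar) ≤ ∑ x ∈ F, N x := by
    intro s
    obtain ⟨x, hx⟩ := Set.mem_iUnion.1 (hF (Set.mem_univ (s.1 (IsLocalRing.closedPoint L))))
    obtain ⟨hxF, hsx⟩ := Set.mem_iUnion.1 hx
    exact (hW x s hsx).2.2.1.trans (Finset.single_le_sum (fun _ _ => Nat.zero_le _) hxF)
  have hgal : ∀ s : KPoints p L,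
      FiniteDimensional L (fibreField f s Lbar) ∧ IsGalois L (fibreField f s Lbar) := fun s =>
    ⟨(hW _ s (hxW _)).1, (hW _ s (hxW _)).2.1⟩
  refine ⟨hgal, ?_⟩
  obtain ⟨n, H, hH, hHfin, hHinj, hHsurj⟩ := exists_group_representatives.{u} (∑ x ∈ F, N x)
  refine ⟨n, H, hH, hHfin, fun i =>
    {s | Nonempty ((fibreField f s Lbar ≃ₐ[L] fibreField f s Lbar) ≃* H i)}, fun i => ?_, ?_, ?_,
    fun i s => Iff.rfl⟩
  -- Openness holds because nearby points have literally the same fibre field inside `Lbar`.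
  · rw [isOpen_iff_mem_nhds]
    intro s hs
    filter_upwards [(hW _ s (hxW _)).2.2.2] with s' hs'
    rw [hs']
    exact hs
  · refine Set.eq_univ_of_forall fun s => Set.mem_iUnion.2 ?_
    have := (hgal s).1
    exact hHsurj _ (hbound s)
  · intro i j hij
    refine Set.disjoint_left.2 fun s ⟨e⟩ ⟨e'⟩ => hij (hHinj i j ⟨e.symm.trans e'⟩)
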